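/- **Setting.** Let $d,s\ge 0$ and $N\ge 1$ be integers, let $D\subseteq\mathbb R^d$ be open with closure $\overline D$, and let $I_s=\{\alpha\in\mathbb N^d:|\alpha|\le s\}$. Let $\mathcal L_s=\sum_{\alpha\in I_s}\varphi_\alpha\partial^\alpha$ with functions $\varphi_\alpha:D\to\mathbb R$, and let $P_s=\mathcal L_s\mathbf 1_D+I\,\mathbf 1_{\partial D}$, that is $$P_su(x)=\sum_{\alpha\in I_s}\phi_\alpha(x)\,\partial^\alpha u(x)\quad(x\in\overline D),\qquad \phi_0=\varphi_0\mathbf 1_D+\mathbf 1_{\partial D},\quad \phi_\alpha=\varphi_\alpha\mathbf 1_D\ (\alpha\neq 0),$$ so that $P_su(x)=\mathcal L_su(x)$ for $x\in D$ and $P_su(x)=u(x)$ for $x\in\partial D$. Let $\mu$ be a Borel probability measure on $\overline D$, assume that the $\phi_\alpha$ are $\mu$-measurable, and let $C$ be a uniform bound for them: $|\phi_\alpha|\le C$ $\mu$-almost everywhere for every $\alpha\in I_s$. Let $K:\overline D\times\overline D\to\mathbb R$ be a Mercer kernel (continuous, symmetric, positive semidefinite) of class $C_b^{2s+1}(\overline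 D\times\overline D)$, meaning that $K$ is $2s+1$ times continuously differentiable in $D\times D$ and that its partial derivatives of order at most $2s+1$ are bounded and extend continuously to $\overline D\times\overline D$. Let $\mathcal H_K$ be its reproducing kernel Hilbert space. Put $C_{d+s}^d=\binom{d+s}{d}$, and let $\kappa\ge 0$ be given by $$\kappa^2=\|K\|_{C_b^{2s}}=\max_{|\alpha|+|\beta|\le 2s}\ \sup_{x,y\in D}|\partial_x^\alpha\partial_y^\beta K(x,y)|.$$ Let $X^{(1)},\dots,X^{(N)}$ be i.i.d. with law $\mu$ and let $\lambda>0$. Define $P_{s,N}:\mathcal H_K\to\mathbb R^N$ by $P_{s,N}u=\frac1{\sqrt N}\big(P_su(X^{(1)}),\dots,P_su(X^{(N)})\big)$, and let $B_s=P_s^*P_s$ and $B_{s,N}=P_{s,N}^*P_{s,N}$, where $P_s$ is regarded as an operator $\mathcal H_K\to L^2(\overline D;\mu)$. For $h\in L^2(\overline D;\mu)$ let $$\mathcal T_\lambda h=(B_s+\lambda I)^{-1}P_s^*h,\qquad \widehat{\mathcal T}_{\lambda,N}h=\tfrac1{\sqrt N}(B_{s,N}+\lambda I)^{-1}P_{s,N}^*\big(h(X^{(1)}),\dots,h(X^{(N)})\big).$$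 Let $\mathcal F$ be the set of all $h\in L^2(\overline D;\mu)$ for which the equation $P_su=h$ ($\mu$-almost everywhere) has a solution $u\in\mathcal H_K$, and write $\mathcal Th$ for such a solution; the result holds for every choice of it. **Proposition 3.1 (Pathwise estimation error bounds).** The maps $P_s:\mathcal H_K\to L^2(\overline D;\mu)$ and $P_{s,N}:\mathcal H_K\to\mathbb R^N$ (for every value of the sample) are well-defined bounded linear operators. For every $h\in\mathcal F$ and every $0<\delta<1$, with probability at least $1-\delta$, $$\big\|\widehat{\mathcal T}_{\lambda,N}h-\mathcal T_\lambda h\big\|_{\mathcal H_K}\le\left(\sqrt{\frac{8\log(2/\delta)}{N}}+1\right)\sqrt{\frac{2\log(2/\delta)}{N\lambda^2}}\,\big(C_{d+s}^d\,C\,\kappa\big)^2\,\|\mathcal Th\|_{\mathcal H_K}\left(1+\frac{C_{d+s}^d\,\kappa\,C}{\sqrt\lambda}\right).$$ -/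

import Mathlib

open MeasureTheory ProbabilityTheory
open scoped ENNReal InnerProductSpace

noncomputable section

namespace PDEKernel

/-- The multi-indices `α ∈ ℕ^d` with `|α| = α₁ + ⋯ + α_d ≤ s`. -/
def multiIndices (d s : ℕ) : Finset (Fin d → ℕ) :=
  {α ∈ Fintype.piFinset (fun _ : Fin d => Finset.range (s + 1)) | ∑ i, α i ≤ s}

theorem mem_multiIndices {d s : ℕ} (α : Fin d → ℕ) :
    α ∈ multiIndices d s ↔ ∑ i, α i ≤ s := by
  simp only [multiIndices, Finset.mem_filter, Fintype.mem_piFinset, Finset.mem_range,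
    and_iff_right_iff_imp]
  intro h i
  have := Finset.single_le_sum (f := α) (fun j _ => Nat.zero_le (α j)) (Finset.mem_univ i)
  omega

/-- The first order partial derivative `∂_i f`. -/
def pderiv {d : ℕ} (i : Fin d) (f : EuclideanSpace ℝ (Fin d) → ℝ) :
    EuclideanSpace ℝ (Fin d) → ℝ :=
  fun x => lineDeriv ℝ f x (EuclideanSpace.single i 1)

/-- The partial derivative `∂^α f = ∂₁^{α₁} ⋯ ∂_d^{α_d} f`. -/
def partialDeriv {d : ℕ} (α : Fin d → ℕ) (f : EuclideanSpace ℝ (Fin d) → ℝ) :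
    EuclideanSpace ℝ (Fin d) → ℝ :=
  (List.finRange d).foldr (fun i g => (pderiv i)^[α i] g) f

section Domain

variable {d : ℕ} (D : Set (EuclideanSpace ℝ (Fin d)))

/-- A function on `closure D`, extended by `0`. The extension only serves to take derivatives at
the points of the open set `D`, where they do not depend on it. -/
def extendZero (u : closure D → ℝ) : EuclideanSpace ℝ (Fin d) → ℝ :=
  Function.extend Subtype.val u 0

/-- A function on `closure D × closure D`, extended by `0` in both variables. -/
def extendKernel (K : closure D → closure D → ℝ) :
    EuclideanSpace ℝ (Fin d) → EuclideanSpace ℝ (Fin d) → ℝ :=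
  fun x y => extendZero D (fun x' => extendZero D (K x') y) x

/-- The mixed partial derivative `∂_x^α ∂_y^β K (x, y)`, for `x, y ∈ D`. -/
def mixedDeriv (K : closure D → closure D → ℝ) (α β : Fin d → ℕ)
    (x y : EuclideanSpace ℝ (Fin d)) : ℝ :=
  partialDeriv α (fun x' => partialDeriv β (fun y' => extendKernel D K x' y') y) x

/-- Mercer kernels on `closure D`: continuous, symmetric and positive semidefinite. -/
structure IsMercerKernel (K : closure D → closure D → ℝ) : Prop where
  continuous : Continuous (fun p : closure D × closure D => K p.1 p.2)
  symm : ∀ x y, K x y = K y x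
  posSemidef : ∀ (n : ℕ) (x : Fin n → closure D) (c : Fin n → ℝ),
    0 ≤ ∑ i, ∑ j, c i * c j * K (x i) (x j)

/-- `K ∈ C_b^k (closure D × closure D)`: `K` is continuous, it is `k` times continuously
differentiable in the open set `D × D`, and its partial derivatives of order at most `k` are
bounded there and extend continuously to `closure D × closure D`. -/
structure IsCb (k : ℕ) (K : closure D → closure D → ℝ) : Prop where
  continuous : Continuous (fun p : closure D × closure D => K p.1 p.2)
  contDiffOn : ContDiffOn ℝ (k : ℕ∞)
    (fun p : EuclideanSpace ℝ (Fin d) × EuclideanSpace ℝ (Fin d) => extendKernel D K p.1 p.2)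
    (D ×ˢ D)
  bounded : ∀ α β : Fin d → ℕ, ∑ i, α i + ∑ i, β i ≤ k →
    ∃ M : ℝ, ∀ x ∈ D, ∀ y ∈ D, |mixedDeriv D K α β x y| ≤ M
  extends_continuously : ∀ α β : Fin d → ℕ, ∑ i, α i + ∑ i, β i ≤ k →
    ∃ g : closure D × closure D → ℝ, Continuous g ∧
      ∀ x y : closure D, (x : EuclideanSpace ℝ (Fin d)) ∈ D → (y : EuclideanSpace ℝ (Fin d)) ∈ D →
        g (x, y) = mixedDeriv D K α β x y

/-- The norm of `C_b^k (closure D × closure D)`, the largest sup norm of a partial derivative of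
order at most `k`. (By continuity it is enough to take the suprema over `D × D`.) -/
def cbNorm (k : ℕ) (K : closure D → closure D → ℝ) : ℝ :=
  sSup {r : ℝ | ∃ α β : Fin d → ℕ, ∑ i, α i + ∑ i, β i ≤ k ∧
    ∃ x ∈ D, ∃ y ∈ D, r = |mixedDeriv D K α β x y|}

/-- The constant `κ` with `κ² = ‖K‖_{C_b^{2s}}`. -/
def kappa (s : ℕ) (K : closure D → closure D → ℝ) : ℝ := √(cbNorm D (2 * s) K)

open Classical in
/-- The coefficients of `P_s = L_s 1_D + I 1_{∂D}`, where `L_s = ∑_{|α| ≤ s} φ_α ∂^α`: in `D` they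
are the `φ_α`; on `∂D` the coefficient of order zero is `1` and the others vanish.
Only the values of `φ_α` in `D` matter. -/
def coeff (φ : (Fin d → ℕ) → EuclideanSpace ℝ (Fin d) → ℝ) (α : Fin d → ℕ) (x : closure D) : ℝ :=
  if (x : EuclideanSpace ℝ (Fin d)) ∈ D then φ α x else if α = 0 then 1 else 0

/-- `P_s u (x)`, for a function `u` on `closure D`. -/
def applyP (s : ℕ) (φ : (Fin d → ℕ) → EuclideanSpace ℝ (Fin d) → ℝ) (u : closure D → ℝ)
    (x : closure D) : ℝ :=
  ∑ α ∈ multiIndices d s, coeff D φ α x * partialDeriv α (extendZero D u) x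

end Domain

section Operators

open Classical in
/-- A bounded linear map, bundled as an operator; all other maps are sent to `0`. -/
def toOperator {V W : Type*} [NormedAddCommGroup V] [NormedSpace ℝ V] [NormedAddCommGroup W]
    [NormedSpace ℝ W] (F : V → W) : V →L[ℝ] W :=
  if h : IsBoundedLinearMap ℝ F then h.toContinuousLinearMap else 0

/-- The regularized operator `A*A + λ I`. -/
def regularized {V W : Type*} [NormedAddCommGroup V] [InnerProductSpace ℝ V] [CompleteSpace V]
    [NormedAddCommGroup W] [InnerProductSpace ℝ W] [CompleteSpace W] (A : V →L[ℝ] W) (lam : ℝ) :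
    V →L[ℝ] V :=
  A.adjoint ∘L A + lam • ContinuousLinearMap.id ℝ V

variable {d : ℕ} (D : Set (EuclideanSpace ℝ (Fin d))) (s : ℕ)
  (φ : (Fin d → ℕ) → EuclideanSpace ℝ (Fin d) → ℝ)
  (H : Type*) [NormedAddCommGroup H] [InnerProductSpace ℝ H] [CompleteSpace H]
  [RKHS ℝ H (closure D) ℝ]

open Classical in
/-- The class of `P_s u` in `L²(closure D; μ)`, for `u` in the space `H` of functions. -/
def mapL2 (μ : Measure (closure D)) (u : H) : Lp ℝ 2 μ :=
  if hu : MemLp (applyP D s φ u) 2 μ then hu.toLp _ else 0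

/-- `P_{s,N} u = N^{-1/2} (P_s u (x₁), …, P_s u (x_N))`, for the sample `x`. -/
def mapSample {N : ℕ} (x : Fin N → closure D) (u : H) : EuclideanSpace ℝ (Fin N) :=
  WithLp.toLp 2 fun i => (√(N : ℝ))⁻¹ * applyP D s φ u (x i)

/-- The operator `P_s : H → L²(closure D; μ)`. -/
def opL2 (μ : Measure (closure D)) : H →L[ℝ] Lp ℝ 2 μ := toOperator (mapL2 D s φ H μ)

/-- The operator `P_{s,N} : H → ℝ^N`. -/
def opSample {N : ℕ} (x : Fin N → closure D) : H →L[ℝ] EuclideanSpace ℝ (Fin N) :=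
  toOperator (mapSample D s φ H x)

/-- The statistical estimator `T_λ h = (B_s + λ I)⁻¹ P_s* h`, with `B_s = P_s* P_s`. -/
def statEstimator (μ : Measure (closure D)) (lam : ℝ) (h : Lp ℝ 2 μ) : H :=
  Ring.inverse (regularized (opL2 D s φ H μ) lam) ((opL2 D s φ H μ).adjoint h)

/-- The empirical estimator `T̂_{λ,N} h = N^{-1/2} (B_{s,N} + λ I)⁻¹ P_{s,N}* (h (x₁), …, h (x_N))`,
with `B_{s,N} = P_{s,N}* P_{s,N}`, for the sample `x`. -/
def empEstimator {N : ℕ} (x : Fin N → closure D) (lam : ℝ) (h : closure D → ℝ) : H :=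
  (√(N : ℝ))⁻¹ • Ring.inverse (regularized (opSample D s φ H x) lam)
    ((opSample D s φ H x).adjoint (WithLp.toLp 2 fun i => h (x i)))

end Operators

/-- For `λ > 0` the operator `A*A + λ I` is invertible, so its `Ring.inverse` is its inverse. -/
theorem isUnit_regularized {V W : Type*} [NormedAddCommGroup V] [InnerProductSpace ℝ V]
    [CompleteSpace V] [NormedAddCommGroup W] [InnerProductSpace ℝ W] [CompleteSpace W]
    (A : V →L[ℝ] W) {lam : ℝ} (hlam : 0 < lam) : IsUnit (regularized A lam) := by
  refine ContinuousLinearMap.isUnit_of_forall_le_norm_inner_map _ (c := ⟨lam, hlam.le⟩) hlam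
    fun x => ?_
  have h : ⟪regularized A lam x, x⟫_ℝ = ‖A x‖ ^ 2 + lam * ‖x‖ ^ 2 := by
    simp [regularized, inner_add_left, inner_smul_left, ContinuousLinearMap.adjoint_inner_left]
  rw [h, Real.norm_of_nonneg (by positivity)]
  change ‖x‖ ^ 2 * lam ≤ _
  nlinarith [sq_nonneg ‖A x‖]

end PDEKernel

end

noncomputable section

namespace PDEKernel

/-! ### Bernstein's inequality in Hilbert space by Pinelis' hyperbolic cosine method -/

section Bernstein

/-! Everything reduces to one random vector. By smoothness of the kernel, the feature map `x ↦ K_x`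
has derivatives up to order `s` in `H`, and `∂^α u(x) = ⟪∂^α K_x, u⟫` for `x` in `D`. Hence `P_s
u(x) = ⟪ψ x, u⟫`, where `ψ x` is the coefficient combination of these derivatives, and `‖ψ x‖ ≤ R =
C_{d+s}^d C κ` almost everywhere. It follows that `B_s w` is the mean of `⟪ψ x, w⟫ ψ x` and `B_{s,N}
w` is its empirical mean (`adjoint_opL2_apply`, `adjoint_opSample_apply`).

Since `h = P_s u` almost everywhere, the two estimators are almost surely `u - λ (B + λ)⁻¹ u` with
`B = B_{s,N}` and `B = B_s`. With `w = (B_s + λ)⁻¹ u`, their difference is exactly `λ (B_{s,N} +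
λ)⁻¹ (B_{s,N} - B_s) w`, and `λ (B_{s,N} + λ)⁻¹` is a contraction (`norm_tikhonov_sub_tikhonov_le`).
The error is thus at most the deviation of an empirical mean of vectors of norm at most `R² ‖u‖ /
λ`. As `w` does not depend on the sample, a Bernstein inequality for vectors is enough; no operator
concentration is needed. The last factor of the stated bound is at least `1` and costs nothing.

Bernstein's inequality comes from controlling `cosh (t ‖S_n‖)` along the partial sums. The
inequality `cosh_norm_add_le` isolates a term linear in the increment, which integrates to zero by
centering, so each summand multiplies the expectation by at most an explicit exponential factor,
whatever the dimension of `H`. -/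

theorem convexOn_cosh_sqrt : ConvexOn ℝ (Set.Ici 0) (fun z => Real.cosh √z) := by
  -- In the variable `z`, `cosh √z` is a power series with nonnegative coefficients, so convexity
  -- holds term by term.
  have key : ∀ z : ℝ, 0 ≤ z →
      HasSum (fun n : ℕ => z ^ n / ((2 * n).factorial : ℝ)) (Real.cosh √z) := fun z hz => by
    simpa only [pow_mul, Real.sq_sqrt hz] using Real.hasSum_cosh √z
  refine ⟨convex_Ici 0, fun x hx y hy a b ha hb hab => ?_⟩
  have hx' : (0 : ℝ) ≤ x := hx
  have hy' : (0 : ℝ) ≤ y := hy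
  refine hasSum_le (fun n => ?_) (key _ (by simp only [smul_eq_mul]; positivity))
    (((key x hx').mul_left a).add ((key y hy').mul_left b))
  have h := (convexOn_pow n).2 hx hy ha hb hab
  simp only [smul_eq_mul] at h ⊢
  calc _ ≤ (a * x ^ n + b * y ^ n) / ((2 * n).factorial : ℝ) := by gcongr
    _ = _ := by ring

variable {H : Type*} [NormedAddCommGroup H] [InnerProductSpace ℝ H]

/-- The right side minus the left side is `(cosh a - sinh a) (sinh b - b)`, a product of nonnegative
factors. -/
theorem cosh_add_le {a b : ℝ} (hb : 0 ≤ b) :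
    Real.cosh (a + b) ≤ Real.cosh a * (Real.exp b - b) + b * Real.sinh a := by
  have h1 : Real.sinh a ≤ Real.cosh a := (Real.sinh_lt_cosh a).le
  have h2 : b ≤ Real.sinh b := Real.self_le_sinh_iff.2 hb
  rw [Real.cosh_add, ← Real.cosh_add_sinh b]
  nlinarith [mul_nonneg (sub_nonneg.2 h1) (sub_nonneg.2 h2)]

theorem cosh_sub_le {a b : ℝ} (hb : 0 ≤ b) :
    Real.cosh (a - b) ≤ Real.cosh a * (Real.exp b - b) - b * Real.sinh a := by
  have := cosh_add_le (a := -a) hb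
  rw [Real.cosh_neg, Real.sinh_neg, show -a + b = -(a - b) by ring, Real.cosh_neg] at this
  linarith

/-- The square `‖s + y‖²` lies between `(‖s‖ - ‖y‖)²` and `(‖s‖ + ‖y‖)²`; convexity of `cosh √z`
then bounds the left side by the two collinear cases. The weight is affine in `⟪s, y⟫`, so the inner
product enters linearly and vanishes on averaging over a centered `y`. -/
theorem cosh_norm_add_le (s y : H) :
    Real.cosh ‖s + y‖ ≤ Real.cosh ‖s‖ * (Real.exp ‖y‖ - ‖y‖)
      + Real.sinh ‖s‖ / ‖s‖ * ⟪s, y⟫_ℝ := by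
  rcases eq_or_ne s 0 with rfl | hs
  · simpa using cosh_add_le (a := 0) (norm_nonneg y)
  rcases eq_or_ne y 0 with rfl | hy
  · simp
  have ha : 0 < ‖s‖ := norm_pos_iff.2 hs
  have hb : 0 < ‖y‖ := norm_pos_iff.2 hy
  have hc := abs_le.1 (abs_real_inner_le_norm s y)
  set a := ‖s‖
  set b := ‖y‖
  set c := ⟪s, y⟫_ℝ
  set θ := (c + a * b) / (2 * (a * b)) with hθ
  have hθ0 : 0 ≤ θ := div_nonneg (by linarith) (by positivity)
  have hθ1 : θ ≤ 1 := (div_le_one (by positivity)).2 (by linarith)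
  have hz : ‖s + y‖ ^ 2 = (1 - θ) * (a - b) ^ 2 + θ * (a + b) ^ 2 := by
    rw [norm_add_sq_real, hθ]; field_simp; ring
  have h := convexOn_cosh_sqrt.2 (sq_nonneg (a - b)) (sq_nonneg (a + b)) (sub_nonneg.2 hθ1) hθ0
    (by ring)
  simp only [smul_eq_mul, ← hz, Real.sqrt_sq (norm_nonneg _), Real.sqrt_sq_eq_abs,
    Real.cosh_abs] at h
  have h1 := mul_le_mul_of_nonneg_left (cosh_sub_le (a := a) hb.le) (sub_nonneg.2 hθ1)
  have h2 := mul_le_mul_of_nonneg_left (cosh_add_le (a := a) hb.le) hθ0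
  have h3 : Real.sinh a / a * c = (2 * θ - 1) * (b * Real.sinh a) := by
    rw [hθ]; field_simp; ring
  rw [h3]
  linarith

/-- Used with `x = t ‖ξ‖` and `y = t b`: it leaves only the second moment of `ξ`, with the usual
Bernstein denominator. -/
theorem exp_sub_self_le {x y : ℝ} (hx : 0 ≤ x) (hxy : x ≤ y) (hy : y < 1) :
    Real.exp x - x ≤ 1 + x ^ 2 / (2 * (1 - y)) := by
  have h := Real.exp_bound' hx (by linarith) (n := 3) (by norm_num)
  norm_num [Finset.sum_range_succ, Nat.factorial] at h
  have h1 : x ^ 2 / 2 * (1 + x) ≤ x ^ 2 / (2 * (1 - y)) := by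
    rw [le_div_iff₀ (by linarith)]
    have : (1 + x) * (1 - y) ≤ 1 := by nlinarith
    nlinarith [mul_le_mul_of_nonneg_left this (sq_nonneg x)]
  nlinarith [pow_nonneg hx 3]

variable {E : Type*} [MeasurableSpace E] {μ : Measure E} [IsProbabilityMeasure μ]
  [CompleteSpace H]

theorem lintegral_cosh_norm_add_le {ξ : E → H} (hξ : StronglyMeasurable ξ) {b v t : ℝ}
    (hb : ∀ᵐ x ∂μ, ‖ξ x‖ ≤ b) (h0 : ∫ x, ξ x ∂μ = 0) (hv : ∫ x, ‖ξ x‖ ^ 2 ∂μ ≤ v)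
    (ht : 0 ≤ t) (htb : t * b < 1) (s : H) :
    ∫⁻ x, ENNReal.ofReal (Real.cosh (t * ‖s + ξ x‖)) ∂μ
      ≤ ENNReal.ofReal (Real.cosh (t * ‖s‖))
        * ENNReal.ofReal (Real.exp (t ^ 2 * v / (2 * (1 - t * b)))) := by
  have hint : Integrable ξ μ := Integrable.of_bound hξ.aestronglyMeasurable b hb
  have hint2 : Integrable (fun x => ‖ξ x‖ ^ 2) μ := by
    refine Integrable.of_bound (by fun_prop) (b ^ 2) ?_
    filter_upwards [hb] with x hx
    rw [Real.norm_of_nonneg (by positivity)]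
    gcongr
  set k := Real.sinh ‖t • s‖ / ‖t • s‖ with hk
  set g : E → ℝ := fun x => Real.cosh (t * ‖s‖) * (1 + t ^ 2 / (2 * (1 - t * b)) * ‖ξ x‖ ^ 2)
    + k * (t * t) * ⟪s, ξ x⟫_ℝ with hg
  have hle : ∀ᵐ x ∂μ, Real.cosh (t * ‖s + ξ x‖) ≤ g x := by
    filter_upwards [hb] with x hx
    have h := cosh_norm_add_le (t • s) (t • ξ x)
    rw [← smul_add, inner_smul_left, inner_smul_right, ← hk] at h
    simp only [norm_smul, Real.norm_of_nonneg ht, conj_trivial] at h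
    have h2 := exp_sub_self_le (x := t * ‖ξ x‖) (by positivity)
      (mul_le_mul_of_nonneg_left hx ht) htb
    have h3 := mul_le_mul_of_nonneg_left h2 (Real.cosh_pos (t * ‖s‖)).le
    have h4 : (t * ‖ξ x‖) ^ 2 / (2 * (1 - t * b)) = t ^ 2 / (2 * (1 - t * b)) * ‖ξ x‖ ^ 2 := by
      ring
    rw [h4] at h3
    simp only [hg]
    linarith
  have hgi1 : Integrable (fun x => Real.cosh (t * ‖s‖)
      * (1 + t ^ 2 / (2 * (1 - t * b)) * ‖ξ x‖ ^ 2)) μ :=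
    ((integrable_const _).add (hint2.const_mul _)).const_mul _
  have hgi2 : Integrable (fun x => k * (t * t) * ⟪s, ξ x⟫_ℝ) μ :=
    (hint.const_inner s).const_mul _
  have hgi : Integrable g μ := hgi1.add hgi2
  have hgint : ∫ x, g x ∂μ = Real.cosh (t * ‖s‖)
      * (1 + t ^ 2 / (2 * (1 - t * b)) * ∫ x, ‖ξ x‖ ^ 2 ∂μ) := by
    simp only [hg]
    rw [integral_add hgi1 hgi2, integral_const_mul, integral_const_mul,
      integral_inner hint, h0, integral_add (integrable_const _) (hint2.const_mul _),
      integral_const_mul]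
    simp
  calc _ ≤ ∫⁻ x, ENNReal.ofReal (g x) ∂μ :=
        lintegral_mono_ae (hle.mono fun x hx => ENNReal.ofReal_le_ofReal hx)
    _ = ENNReal.ofReal (∫ x, g x ∂μ) := by
        refine (ofReal_integral_eq_lintegral_ofReal hgi ?_).symm
        filter_upwards [hle] with x hx using (Real.cosh_pos _).le.trans hx
    _ ≤ _ := by
        rw [hgint, ← ENNReal.ofReal_mul (Real.cosh_pos _).le]
        refine ENNReal.ofReal_le_ofReal (mul_le_mul_of_nonneg_left ?_ (Real.cosh_pos _).le)
        have h1 : t ^ 2 / (2 * (1 - t * b)) * ∫ x, ‖ξ x‖ ^ 2 ∂μ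
            ≤ t ^ 2 / (2 * (1 - t * b)) * v :=
          mul_le_mul_of_nonneg_left hv (div_nonneg (sq_nonneg t) (by linarith))
        have h2 := Real.add_one_le_exp (t ^ 2 * v / (2 * (1 - t * b)))
        have h3 : t ^ 2 / (2 * (1 - t * b)) * v = t ^ 2 * v / (2 * (1 - t * b)) := by ring
        linarith

/-- Induction with an arbitrary starting vector `s`: by Tonelli the first summand is frozen and
absorbed into `s`, and is integrated last. -/
theorem lintegral_cosh_norm_sum_le {ξ : E → H} (hξ : StronglyMeasurable ξ) {b v t : ℝ}
    (hb : ∀ᵐ x ∂μ, ‖ξ x‖ ≤ b) (h0 : ∫ x, ξ x ∂μ = 0) (hv : ∫ x, ‖ξ x‖ ^ 2 ∂μ ≤ v)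
    (ht : 0 ≤ t) (htb : t * b < 1) (n : ℕ) (s : H) :
    ∫⁻ x, ENNReal.ofReal (Real.cosh (t * ‖s + ∑ i, ξ (x i)‖)) ∂(Measure.pi fun _ : Fin n => μ)
      ≤ ENNReal.ofReal (Real.cosh (t * ‖s‖))
        * ENNReal.ofReal (Real.exp (t ^ 2 * v / (2 * (1 - t * b)))) ^ n := by
  induction n generalizing s with
  | zero => simp
  | succ n ih =>
    have hmp := (measurePreserving_piFinSuccAbove (fun _ : Fin (n + 1) => μ) 0).symm
    have hmeas : ∀ m : ℕ, StronglyMeasurable fun x : Fin m → E => ∑ i, ξ (x i) := fun m =>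
      Finset.stronglyMeasurable_fun_sum _ fun i _ => hξ.comp_measurable (measurable_pi_apply i)
    have hF : Measurable fun x : Fin (n + 1) → E =>
        ENNReal.ofReal (Real.cosh (t * ‖s + ∑ i, ξ (x i)‖)) :=
      ((Real.continuous_cosh.measurable.comp
        ((stronglyMeasurable_const.add (hmeas _)).norm.measurable.const_mul t))).ennreal_ofReal
    rw [← hmp.lintegral_comp hF]
    refine (lintegral_prod _ (hF.comp hmp.measurable).aemeasurable).trans_le ?_
    calc _ ≤ ∫⁻ x, ENNReal.ofReal (Real.cosh (t * ‖s + ξ x‖))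
          * ENNReal.ofReal (Real.exp (t ^ 2 * v / (2 * (1 - t * b)))) ^ n ∂μ := by
          refine lintegral_mono fun x => ?_
          refine le_trans (le_of_eq ?_) (ih (s + ξ x))
          refine lintegral_congr fun y => ?_
          simp [Fin.sum_univ_succ, MeasurableEquiv.piFinSuccAbove, add_assoc]
      _ ≤ _ := by
          rw [lintegral_mul_const' _ _ (by finiteness), pow_succ' (ENNReal.ofReal _) n, ← mul_assoc]
          gcongr
          exact lintegral_cosh_norm_add_le hξ hb h0 hv ht htb s

/-- Markov's inequality for `cosh (t ‖S_n‖)`; the factor `2` comes from `cosh (t r) ≥ exp (t r) /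
2`. -/
theorem measure_pi_le_norm_sum {ξ : E → H} (hξ : StronglyMeasurable ξ) {b v t : ℝ}
    (hb : ∀ᵐ x ∂μ, ‖ξ x‖ ≤ b) (h0 : ∫ x, ξ x ∂μ = 0) (hv : ∫ x, ‖ξ x‖ ^ 2 ∂μ ≤ v)
    (ht : 0 ≤ t) (htb : t * b < 1) (n : ℕ) {r : ℝ} (hr : 0 ≤ r) :
    (Measure.pi fun _ : Fin n => μ) {x | r ≤ ‖∑ i, ξ (x i)‖}
      ≤ ENNReal.ofReal (2 * Real.exp (n * (t ^ 2 * v / (2 * (1 - t * b))) - t * r)) := by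
  have hmeas : StronglyMeasurable fun x : Fin n → E => ∑ i, ξ (x i) :=
    Finset.stronglyMeasurable_fun_sum _ fun i _ => hξ.comp_measurable (measurable_pi_apply i)
  have hF : Measurable fun x : Fin n → E =>
      ENNReal.ofReal (Real.cosh (t * ‖0 + ∑ i, ξ (x i)‖)) :=
    ((Real.continuous_cosh.measurable.comp
      ((stronglyMeasurable_const.add hmeas).norm.measurable.const_mul t))).ennreal_ofReal
  have h1 := lintegral_cosh_norm_sum_le hξ hb h0 hv ht htb n 0
  have h2 := mul_meas_ge_le_lintegral₀ (μ := Measure.pi fun _ : Fin n => μ) hF.aemeasurable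
    (ENNReal.ofReal (Real.exp (t * r) / 2))
  have h3 : {x : Fin n → E | r ≤ ‖∑ i, ξ (x i)‖} ⊆
      {x | ENNReal.ofReal (Real.exp (t * r) / 2)
        ≤ ENNReal.ofReal (Real.cosh (t * ‖0 + ∑ i, ξ (x i)‖))} := fun x hx => by
    refine ENNReal.ofReal_le_ofReal ?_
    rw [zero_add]
    have h4 : Real.cosh (t * r) ≤ Real.cosh (t * ‖∑ i, ξ (x i)‖) := by
      rw [Real.cosh_le_cosh, abs_of_nonneg (by positivity), abs_of_nonneg (by positivity)]
      exact mul_le_mul_of_nonneg_left hx ht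
    have := Real.cosh_eq (t * r)
    have := Real.exp_pos (-(t * r))
    linarith
  have hpos : 0 < Real.exp (t * r) / 2 := by positivity
  have h5 : ENNReal.ofReal (Real.exp (t * r) / 2)
      * (Measure.pi fun _ : Fin n => μ) {x | r ≤ ‖∑ i, ξ (x i)‖}
      ≤ ENNReal.ofReal (Real.exp (n * (t ^ 2 * v / (2 * (1 - t * b))))) := by
    refine (mul_le_mul_right (measure_mono h3) _).trans (h2.trans (h1.trans (le_of_eq ?_)))
    rw [norm_zero, mul_zero, Real.cosh_zero, ENNReal.ofReal_one, one_mul,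
      ← ENNReal.ofReal_pow (Real.exp_pos _).le, ← Real.exp_nat_mul]
  rw [mul_comm, ← ENNReal.le_div_iff_mul_le (by simp [hpos]) (by simp),
    ← ENNReal.ofReal_div_of_pos hpos] at h5
  refine h5.trans (ENNReal.ofReal_le_ofReal (le_of_eq ?_))
  rw [Real.exp_sub]
  field_simp

/-- **Bernstein's inequality** for bounded centered independent identically distributed vectors
in a Hilbert space, with the dimension free constant of Pinelis. -/
theorem measure_pi_lt_norm_sum_le {ξ : E → H} (hξ : StronglyMeasurable ξ) {b σ : ℝ}
    (hb0 : 0 ≤ b) (hσ : 0 ≤ σ)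
    (hb : ∀ᵐ x ∂μ, ‖ξ x‖ ≤ b) (h0 : ∫ x, ξ x ∂μ = 0) (hv : ∫ x, ‖ξ x‖ ^ 2 ∂μ ≤ σ ^ 2)
    {n : ℕ} (hn : 0 < n) {L : ℝ} (hL : 0 < L) :
    (Measure.pi fun _ : Fin n => μ) {x | σ * √(2 * n * L) + b * L < ‖∑ i, ξ (x i)‖}
      ≤ ENNReal.ofReal (2 * Real.exp (-L)) := by
  have hn' : (0 : ℝ) < n := Nat.cast_pos.2 hn
  -- The choice of `t` below divides by `σ`; if `σ = 0`, the vectors vanish almost surely.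
  rcases hσ.eq_or_lt with rfl | hσ
  · have hint2 : Integrable (fun x => ‖ξ x‖ ^ 2) μ := by
      refine Integrable.of_bound (by fun_prop) (b ^ 2) ?_
      filter_upwards [hb] with x hx
      rw [Real.norm_of_nonneg (by positivity)]
      gcongr
    have hz : ∀ᵐ x ∂μ, ξ x = 0 := by
      have h := (integral_eq_zero_iff_of_nonneg (fun x => sq_nonneg ‖ξ x‖) hint2).1
        (le_antisymm (by simpa using hv) (integral_nonneg fun x => sq_nonneg ‖ξ x‖))
      filter_upwards [h] with x hx
      simpa using hx
    have hz' : ∀ᵐ x ∂(Measure.pi fun _ : Fin n => μ), ∀ i, ξ (x i) = 0 :=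
      ae_all_iff.2 fun i =>
        (Measure.quasiMeasurePreserving_eval (fun _ : Fin n => μ) i).ae hz
    have : (Measure.pi fun _ : Fin n => μ)
        {x | 0 * √(2 * n * L) + b * L < ‖∑ i, ξ (x i)‖} = 0 := by
      refine measure_mono_null ?_ hz'
      intro x hx hx'
      simp only [Set.mem_ofPred_eq] at hx hx'
      rw [Finset.sum_eq_zero fun i _ => hx' i] at hx
      have : 0 ≤ b * L := by positivity
      simp only [norm_zero] at hx
      linarith
    rw [this]
    exact zero_le
  · set q := √(2 * n * L) / (n * σ) with hq
    have hq0 : 0 < q := by positivity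
    have hsq : √(2 * n * L) = q * (n * σ) := by rw [hq]; field_simp
    have hq2 : q ^ 2 * n * σ ^ 2 = 2 * L := by
      have := Real.sq_sqrt (show 0 ≤ 2 * n * L by positivity)
      rw [hsq] at this
      have h' : n * (q ^ 2 * n * σ ^ 2) = n * (2 * L) := by linarith
      exact mul_left_cancel₀ hn'.ne' h'
    have h1 : 0 < 1 + b * q := by positivity
    -- With this `t`, `1 - t b = 1 / (1 + b q)`, and since `q² n σ² = 2 L` the exponent is exactly
    -- `-L`.
    set t := q / (1 + b * q) with ht
    have htb : 1 - t * b = 1 / (1 + b * q) := by rw [ht]; field_simp; ring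
    have h := measure_pi_le_norm_sum hξ hb h0 hv (t := t) (by positivity)
      (by have : 0 < 1 / (1 + b * q) := by positivity
          linarith) n (r := σ * √(2 * n * L) + b * L) (by positivity)
    have hsub : {x : Fin n → E | σ * √(2 * n * L) + b * L < ‖∑ i, ξ (x i)‖}
        ⊆ {x | σ * √(2 * n * L) + b * L ≤ ‖∑ i, ξ (x i)‖} := fun x hx => by
      rw [Set.mem_ofPred_eq] at hx ⊢
      exact hx.le
    refine (measure_mono hsub).trans (h.trans (le_of_eq ?_))
    congr 3
    rw [htb, hsq, ht]
    have h2 : (n : ℝ) * ((q / (1 + b * q)) ^ 2 * σ ^ 2 / (2 * (1 / (1 + b * q))))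
        = (q ^ 2 * n * σ ^ 2) / (2 * (1 + b * q)) := by field_simp
    have h3 : q / (1 + b * q) * (σ * (q * (n * σ)) + b * L)
        = (q ^ 2 * n * σ ^ 2 + b * q * L) / (1 + b * q) := by field_simp
    rw [h2, h3, hq2]
    field_simp
    ring

end Bernstein

/-! ### Deviation of the empirical mean -/

section Concentration

variable {E : Type*} [MeasurableSpace E] {μ : Measure E} [IsProbabilityMeasure μ]
  {H : Type*} [NormedAddCommGroup H] [InnerProductSpace ℝ H] [CompleteSpace H]

theorem integral_norm_sub_integral_sq_le {ξ : E → H} (hξ : AEStronglyMeasurable ξ μ) {M : ℝ}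
    (hM : ∀ᵐ x ∂μ, ‖ξ x‖ ≤ M) :
    ∫ x, ‖ξ x - ∫ y, ξ y ∂μ‖ ^ 2 ∂μ ≤ M ^ 2 := by
  have hint : Integrable ξ μ := Integrable.of_bound hξ M hM
  have hsq : ∀ᵐ x ∂μ, ‖ξ x‖ ^ 2 ≤ M ^ 2 := hM.mono fun x hx => by gcongr
  have hint2 : Integrable (fun x => ‖ξ x‖ ^ 2) μ := by
    refine Integrable.of_bound (by fun_prop) (M ^ 2) ?_
    filter_upwards [hsq] with x hx
    rwa [Real.norm_of_nonneg (by positivity)]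
  set m := ∫ y, ξ y ∂μ with hm
  have h1 : ∫ x, ‖ξ x - m‖ ^ 2 ∂μ = ∫ x, ‖ξ x‖ ^ 2 ∂μ - ‖m‖ ^ 2 := by
    have h2 : ∀ x, ‖ξ x - m‖ ^ 2 = ‖ξ x‖ ^ 2 - 2 * ⟪m, ξ x⟫_ℝ + ‖m‖ ^ 2 := fun x => by
      rw [norm_sub_sq_real, real_inner_comm]
    have hi : Integrable (fun x => 2 * ⟪m, ξ x⟫_ℝ) μ := (hint.const_inner m).const_mul 2
    have hi2 : Integrable (fun x => ‖ξ x‖ ^ 2 - 2 * ⟪m, ξ x⟫_ℝ) μ := hint2.sub hi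
    simp_rw [h2]
    rw [integral_add hi2 (integrable_const _), integral_sub hint2 hi,
      integral_const_mul, integral_inner hint, ← hm, real_inner_self_eq_norm_sq]
    simp
    ring
  have h3 : ∫ x, ‖ξ x‖ ^ 2 ∂μ ≤ ∫ _, M ^ 2 ∂μ :=
    integral_mono_ae hint2 (integrable_const _) hsq
  simp only [integral_const, probReal_univ, smul_eq_mul, one_mul] at h3
  rw [h1]
  nlinarith [sq_nonneg ‖m‖]

/-- Deviation bound for the empirical mean of a bounded function with values in a Hilbert
space. -/
theorem prob_norm_mean_sub_integral_le {Ω : Type*} [MeasurableSpace Ω] {P : Measure Ω}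
    [IsProbabilityMeasure P] {N : ℕ} (hN : 0 < N) {X : Fin N → Ω → E}
    (hX : ∀ i, HasLaw (X i) μ P) (hXind : iIndepFun X P)
    {ξ : E → H} (hξ : AEStronglyMeasurable ξ μ) {M : ℝ} (hM : ∀ᵐ x ∂μ, ‖ξ x‖ ≤ M)
    (hM0 : 0 ≤ M) {δ : ℝ} (hδ : 0 < δ) (hδ1 : δ < 1) :
    ENNReal.ofReal (1 - δ) ≤ P {ω | ‖(N : ℝ)⁻¹ • ∑ i, ξ (X i ω) - ∫ x, ξ x ∂μ‖
      ≤ (√(8 * Real.log (2 / δ) / N) + 1) * √(2 * Real.log (2 / δ) / N) * M} := by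
  have hN' : (0 : ℝ) < N := Nat.cast_pos.2 hN
  set L := Real.log (2 / δ) with hL
  have hL0 : 0 < L := Real.log_pos (by rw [lt_div_iff₀ hδ]; linarith)
  set m := ∫ x, ξ x ∂μ with hm
  -- The centered function is built from a strongly measurable version of `ξ`, as Bernstein's
  -- inequality requires; along the sample the two agree almost surely.
  set η : E → H := fun x => hξ.mk ξ x - m with hη
  have hηm : StronglyMeasurable η := hξ.stronglyMeasurable_mk.sub stronglyMeasurable_const
  have hηξ : ∀ᵐ x ∂μ, η x = ξ x - m := hξ.ae_eq_mk.mono fun x hx => by simp only [hη, ← hx]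
  have hint : Integrable ξ μ := Integrable.of_bound hξ M hM
  have hmM : ‖m‖ ≤ M := by
    simpa using norm_integral_le_of_norm_le_const hM
  have hηb : ∀ᵐ x ∂μ, ‖η x‖ ≤ 2 * M := by
    filter_upwards [hηξ, hM] with x hx hx'
    rw [hx]
    linarith [norm_sub_le (ξ x) m]
  have hη0 : ∫ x, η x ∂μ = 0 := by
    rw [integral_congr_ae hηξ, integral_sub hint (integrable_const _)]
    simp [hm]
  have hηv : ∫ x, ‖η x‖ ^ 2 ∂μ ≤ M ^ 2 := by
    refine le_trans (le_of_eq (integral_congr_ae ?_)) (integral_norm_sub_integral_sq_le hξ hM)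
    filter_upwards [hηξ] with x hx
    rw [hx]
  have hbern := measure_pi_lt_norm_sum_le hηm (by positivity) hM0 hηb hη0 hηv hN hL0
  have hexp : 2 * Real.exp (-L) = δ := by
    rw [Real.exp_neg, hL, Real.exp_log (by positivity)]
    field_simp
  rw [hexp] at hbern
  set B : Set (Fin N → E) := {x | M * √(2 * N * L) + 2 * M * L < ‖∑ i, η (x i)‖} with hB
  have hBm : MeasurableSet B :=
    measurableSet_lt measurable_const
      (Finset.stronglyMeasurable_fun_sum _ fun i _ =>
        hηm.comp_measurable (measurable_pi_apply i)).norm.measurable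
  have hXm : ∀ i, AEMeasurable (X i) P := fun i => (hX i).aemeasurable
  have hXm' : AEMeasurable (fun ω i => X i ω) P := aemeasurable_pi_lambda _ hXm
  have hlaw : P.map (fun ω i => X i ω) = Measure.pi fun _ => μ := by
    rw [(iIndepFun_iff_map_fun_eq_pi_map hXm).1 hXind]
    congr 1
    funext i
    exact (hX i).map_eq
  have hgood : ENNReal.ofReal (1 - δ) ≤ P ((fun ω i => X i ω) ⁻¹' Bᶜ) := by
    rw [← Measure.map_apply_of_aemeasurable hXm' hBm.compl, hlaw, prob_compl_eq_one_sub hBm,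
      ENNReal.ofReal_sub _ hδ.le, ENNReal.ofReal_one]
    exact tsub_le_tsub_left hbern 1
  refine hgood.trans (measure_mono_ae ?_)
  have hae : ∀ᵐ ω ∂P, ∀ i, η (X i ω) = ξ (X i ω) - m := by
    refine ae_all_iff.2 fun i => ?_
    have h1 : ∀ᵐ x ∂(P.map (X i)), η x = ξ x - m := by rw [(hX i).map_eq]; exact hηξ
    exact ae_of_ae_map (hXm i) h1
  filter_upwards [hae] with ω hω hωB
  have hωB' : ‖∑ i, η (X i ω)‖ ≤ M * √(2 * N * L) + 2 * M * L := not_lt.1 hωB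
  show ‖(N : ℝ)⁻¹ • ∑ i, ξ (X i ω) - m‖ ≤ _
  have h1 : (N : ℝ)⁻¹ • ∑ i, ξ (X i ω) - m = (N : ℝ)⁻¹ • ∑ i, η (X i ω) := by
    simp only [hω, Finset.sum_sub_distrib, smul_sub, Finset.sum_const, Finset.card_univ,
      Fintype.card_fin]
    rw [← Nat.cast_smul_eq_nsmul ℝ, smul_smul, inv_mul_cancel₀ hN'.ne', one_smul]
  rw [h1, norm_smul, Real.norm_of_nonneg (by positivity), inv_mul_le_iff₀ hN']
  refine hωB'.trans ?_
  -- With `q = √(2 L / N)`, Bernstein gives `M (q + q²)` after division by `N`, and the claim allows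
  -- `M (q + 2 q²)`.
  have h2 : √(8 * L / N) = 2 * √(2 * L / N) := by
    rw [show 8 * L / N = 2 ^ 2 * (2 * L / N) by ring, Real.sqrt_mul (by positivity),
      Real.sqrt_sq (by positivity)]
  have h3 : √(2 * N * L) = N * √(2 * L / N) := by
    rw [show 2 * N * L = N ^ 2 * (2 * L / N) by field_simp, Real.sqrt_mul (by positivity),
      Real.sqrt_sq (by positivity)]
  have h4 : N * √(2 * L / N) ^ 2 = 2 * L := by
    rw [Real.sq_sqrt (by positivity)]; field_simp
  rw [h2, h3]
  have h5 : N * ((2 * √(2 * L / N) + 1) * √(2 * L / N) * M)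
      = M * (N * √(2 * L / N)) + 2 * M * (N * √(2 * L / N) ^ 2) := by ring
  rw [h5, h4]
  nlinarith [mul_nonneg hM0 hL0.le]

end Concentration

/-! ### Perturbation of Tikhonov regularization -/

section Regularized

variable {V W W' : Type*} [NormedAddCommGroup V] [InnerProductSpace ℝ V] [CompleteSpace V]
  [NormedAddCommGroup W] [InnerProductSpace ℝ W] [CompleteSpace W]
  [NormedAddCommGroup W'] [InnerProductSpace ℝ W'] [CompleteSpace W']

theorem regularized_apply (A : V →L[ℝ] W) (lam : ℝ) (v : V) :
    regularized A lam v = A.adjoint (A v) + lam • v := by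
  simp [regularized]

theorem regularized_inverse_apply (A : V →L[ℝ] W) {lam : ℝ} (hlam : 0 < lam) (v : V) :
    regularized A lam (Ring.inverse (regularized A lam) v) = v :=
  congrArg (fun T : V →L[ℝ] V => T v) (Ring.mul_inverse_cancel _ (isUnit_regularized A hlam))

theorem inverse_regularized_apply (A : V →L[ℝ] W) {lam : ℝ} (hlam : 0 < lam) (v : V) :
    Ring.inverse (regularized A lam) (regularized A lam v) = v :=
  congrArg (fun T : V →L[ℝ] V => T v) (Ring.inverse_mul_cancel _ (isUnit_regularized A hlam))

/-- Coercivity: `⟪(A*A + λ) y, y⟫ ≥ λ ‖y‖²`, combined with Cauchy–Schwarz. -/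
theorem norm_inverse_regularized_le (A : V →L[ℝ] W) {lam : ℝ} (hlam : 0 < lam) (v : V) :
    lam * ‖Ring.inverse (regularized A lam) v‖ ≤ ‖v‖ := by
  set y := Ring.inverse (regularized A lam) v with hy
  have h1 : ⟪regularized A lam y, y⟫_ℝ = ‖A y‖ ^ 2 + lam * ‖y‖ ^ 2 := by
    simp [regularized, inner_add_left, inner_smul_left, ContinuousLinearMap.adjoint_inner_left]
  rw [regularized_inverse_apply A hlam] at h1
  have h2 := real_inner_le_norm v y
  rcases (norm_nonneg y).eq_or_lt with h | h
  · rw [← h]; simp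
  · refine le_of_mul_le_mul_right ?_ h
    nlinarith [sq_nonneg ‖A y‖]

/-- Writing `A*A = (A*A + λ) - λ` turns each regularized solution into `u - λ (A*A + λ)⁻¹ u`. The
resolvent identity then leaves `λ (A'*A' + λ)⁻¹` applied to the vector on the right, and this
operator is a contraction. -/
theorem norm_tikhonov_sub_tikhonov_le (A : V →L[ℝ] W) (A' : V →L[ℝ] W') {lam : ℝ}
    (hlam : 0 < lam) (u : V) :
    ‖Ring.inverse (regularized A' lam) (A'.adjoint (A' u))
        - Ring.inverse (regularized A lam) (A.adjoint (A u))‖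
      ≤ ‖A'.adjoint (A' (Ring.inverse (regularized A lam) u))
        - A.adjoint (A (Ring.inverse (regularized A lam) u))‖ := by
  have e1 : A.adjoint (A u) = regularized A lam u - lam • u := by simp [regularized_apply]
  have e2 : A'.adjoint (A' u) = regularized A' lam u - lam • u := by simp [regularized_apply]
  set w := Ring.inverse (regularized A lam) u with hw
  have e3 : A'.adjoint (A' w) - A.adjoint (A w) = regularized A' lam w - u := by
    have := regularized_inverse_apply A hlam u
    rw [← hw, regularized_apply] at this
    rw [regularized_apply, ← this]
    abel
  rw [e1, e2, map_sub, map_sub, inverse_regularized_apply A hlam, inverse_regularized_apply A' hlam,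
    map_smul, map_smul, ← hw, e3]
  refine le_trans (le_of_eq ?_) (norm_inverse_regularized_le A' hlam _)
  rw [map_sub, inverse_regularized_apply A' hlam, sub_sub_sub_cancel_left, ← smul_sub, norm_smul,
    Real.norm_of_nonneg hlam.le]

end Regularized

/-! ### Regularity of a Hilbert-valued map from its Gram kernel -/

section FeatureMap
open Filter Topology

variable {H : Type*} [NormedAddCommGroup H] [InnerProductSpace ℝ H]

/-- Where the Gram kernel of a curve in a Hilbert space has a continuous mixed second derivative,
the curve is differentiable. -/
theorem differentiableAt_of_mixed_deriv_inner [CompleteSpace H] {g : ℝ → H} {a b : ℝ → ℝ → ℝ}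
    (ha : ∀ᶠ p in 𝓝 (0 : ℝ × ℝ), HasDerivAt (fun r => ⟪g p.1, g r⟫_ℝ) (a p.1 p.2) p.2)
    (hb : ∀ᶠ p in 𝓝 (0 : ℝ × ℝ), HasDerivAt (fun t => a t p.2) (b p.1 p.2) p.1)
    (hc : ContinuousAt (fun p : ℝ × ℝ => b p.1 p.2) 0) : DifferentiableAt ℝ g 0 := by
  set c := b 0 0 with hcdef
  -- The second difference of the Gram kernel is `c t r` up to `ε |t| |r|`, by the mean value
  -- inequality in `t` and then in `r`.
  have key : ∀ ε > 0, ∃ η > 0, ∀ t r : ℝ, |t| < η → |r| < η →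
      |⟪g t - g 0, g r - g 0⟫_ℝ - c * t * r| ≤ ε * |t| * |r| := by
    intro ε hε
    have h3 : ∀ᶠ p in 𝓝 (0 : ℝ × ℝ), |b p.1 p.2 - c| < ε := by
      have := Metric.tendsto_nhds.1 hc ε hε
      simpa [Real.dist_eq] using this
    obtain ⟨η, hη, h⟩ := Metric.eventually_nhds_iff.1 (ha.and (hb.and h3))
    have h' : ∀ t r : ℝ, |t| < η → |r| < η →
        HasDerivAt (fun r => ⟪g t, g r⟫_ℝ) (a t r) r ∧ HasDerivAt (fun t => a t r) (b t r) t ∧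
          |b t r - c| < ε := fun t r ht hr =>
      @h (t, r) (by simpa [Prod.dist_eq, Real.dist_eq] using ⟨ht, hr⟩)
    have h0 : |(0 : ℝ)| < η := by simpa using hη
    have hball : ∀ {x : ℝ}, x ∈ Metric.ball (0 : ℝ) η ↔ |x| < η := fun {x} => by
      simp
    refine ⟨η, hη, fun t r ht hr => ?_⟩
    have hda : ∀ r, |r| < η → |a t r - a 0 r - c * t| ≤ ε * |t| := fun r hr => by
      have := (convex_ball (0 : ℝ) η).norm_image_sub_le_of_norm_hasDerivWithin_le
        (f := fun t => a t r - c * t) (f' := fun t => b t r - c) (C := ε) (x := 0) (y := t)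
        (fun x hx => by
          have h1 := (h' x r (hball.1 hx) hr).2.1.sub ((hasDerivAt_id x).const_mul c)
          rw [mul_one] at h1
          exact h1.hasDerivWithinAt)
        (fun x hx => (h' x r (hball.1 hx) hr).2.2.le) (hball.2 h0) (hball.2 ht)
      simp only [Real.norm_eq_abs, mul_zero, sub_zero] at this
      rwa [show a t r - a 0 r - c * t = a t r - c * t - a 0 r by ring]
    have := (convex_ball (0 : ℝ) η).norm_image_sub_le_of_norm_hasDerivWithin_le
      (f := fun r => ⟪g t, g r⟫_ℝ - ⟪g 0, g r⟫_ℝ - c * t * r)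
      (f' := fun r => a t r - a 0 r - c * t) (C := ε * |t|) (x := 0) (y := r)
      (fun x hx => by
        have h1 := ((h' t x ht (hball.1 hx)).1.sub (h' 0 x h0 (hball.1 hx)).1).sub
          ((hasDerivAt_id x).const_mul (c * t))
        rw [mul_one] at h1
        exact h1.hasDerivWithinAt)
      (fun x hx => hda x (hball.1 hx)) (hball.2 h0) (hball.2 hr)
    simp only [Real.norm_eq_abs, mul_zero, sub_zero] at this
    rw [inner_sub_left, inner_sub_right, inner_sub_right]
    convert this using 2
    ring
  set D : ℝ → H := fun t => t⁻¹ • (g (0 + t) - g 0) with hD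
  have hDD : ∀ ε > 0, ∃ η > 0, ∀ t r : ℝ, t ≠ 0 → r ≠ 0 → |t| < η → |r| < η →
      |⟪D t, D r⟫_ℝ - c| ≤ ε := by
    intro ε hε
    obtain ⟨η, hη, h⟩ := key ε hε
    refine ⟨η, hη, fun t r ht0 hr0 ht hr => ?_⟩
    have h1 := h t r ht hr
    have h2 : ⟪D t, D r⟫_ℝ - c = (t * r)⁻¹ * (⟪g t - g 0, g r - g 0⟫_ℝ - c * t * r) := by
      simp only [hD, zero_add, inner_smul_left, inner_smul_right, conj_trivial]
      field_simp
    rw [h2, abs_mul, abs_inv, abs_mul, inv_mul_le_iff₀ (by positivity)]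
    linarith
  -- All inner products of difference quotients tend to `c`, so `‖D t - D r‖²` tends to `c - 2 c + c
  -- = 0`; completeness of `H` supplies the derivative.
  have hcau : Cauchy (map D (𝓝[≠] 0)) := by
    rw [Metric.cauchy_iff]
    refine ⟨inferInstance, fun ε hε => ?_⟩
    obtain ⟨η, hη, h⟩ := hDD (ε ^ 2 / 8) (by positivity)
    refine ⟨D '' (Metric.ball 0 η ∩ {0}ᶜ), image_mem_map
      (inter_mem (mem_nhdsWithin_of_mem_nhds (Metric.ball_mem_nhds 0 hη))
        self_mem_nhdsWithin), ?_⟩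
    rintro _ ⟨t, ⟨ht, ht0⟩, rfl⟩ _ ⟨r, ⟨hr, hr0⟩, rfl⟩
    rw [mem_ball_zero_iff, Real.norm_eq_abs] at ht hr
    have h1 := abs_le.1 (h t t ht0 ht0 ht ht)
    have h2 := abs_le.1 (h t r ht0 hr0 ht hr)
    have h3 := abs_le.1 (h r r hr0 hr0 hr hr)
    rw [dist_eq_norm]
    refine lt_of_pow_lt_pow_left₀ 2 hε.le ?_
    rw [norm_sub_sq_real, ← real_inner_self_eq_norm_sq, ← real_inner_self_eq_norm_sq]
    have : 0 < ε ^ 2 := by positivity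
    linarith
  obtain ⟨l, hl⟩ := CompleteSpace.complete hcau
  exact (hasDerivAt_iff_tendsto_slope_zero.2 hl).differentiableAt

/-- Expanding `‖G y - G x‖²` expresses it through the Gram kernel alone. -/
theorem continuousOn_of_continuousOn_inner {T : Type*} [TopologicalSpace T] {G : T → H}
    {S : Set T} (hG : ContinuousOn (fun p : T × T => ⟪G p.1, G p.2⟫_ℝ) (S ×ˢ S)) :
    ContinuousOn G S := by
  intro x hx
  have hxx := hG (x, x) ⟨hx, hx⟩
  have hid : Tendsto (fun y : T => y) (𝓝[S] x) (𝓝[S] x) := tendsto_id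
  have hcst : Tendsto (fun _ : T => x) (𝓝[S] x) (𝓝[S] x) :=
    tendsto_nhdsWithin_iff.2 ⟨tendsto_const_nhds, Eventually.of_forall fun _ => hx⟩
  have hxx' : Tendsto (fun p : T × T => ⟪G p.1, G p.2⟫_ℝ) (𝓝[S] x ×ˢ 𝓝[S] x)
      (𝓝 ⟪G x, G x⟫_ℝ) := by
    rw [← nhdsWithin_prod_eq]; exact hxx
  have h1 := hxx'.comp (hid.prodMk hid)
  have h2 := hxx'.comp (hid.prodMk hcst)
  have h3 : Tendsto (fun y => ‖G y - G x‖ ^ 2) (𝓝[S] x) (𝓝 0) := by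
    have h4 := (h1.sub (h2.const_mul 2)).add
      (tendsto_const_nhds (x := ⟪G x, G x⟫_ℝ))
    have h5 : ⟪G x, G x⟫_ℝ - 2 * ⟪G x, G x⟫_ℝ + ⟪G x, G x⟫_ℝ = 0 := by ring
    rw [h5] at h4
    refine h4.congr fun y => ?_
    rw [norm_sub_sq_real, ← real_inner_self_eq_norm_sq, ← real_inner_self_eq_norm_sq]
    rfl
  refine tendsto_iff_norm_sub_tendsto_zero.2 ?_
  have h4 := h3.sqrt
  simpa [Real.sqrt_sq (norm_nonneg _)] using h4

variable {V : Type*} [NormedAddCommGroup V] [NormedSpace ℝ V]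

section Directional

variable {D : Set V} {F : V × V → ℝ} {v : V} {n : ℕ}

theorem contDiffOn_fderiv_apply (hD : IsOpen D) (hF : ContDiffOn ℝ ((n + 1 : ℕ) : ℕ∞) F (D ×ˢ D))
    (w : V × V) : ContDiffOn ℝ (n : ℕ∞) (fun p => fderiv ℝ F p w) (D ×ˢ D) :=
  (hF.fderiv_of_isOpen (hD.prod hD) (by norm_cast)).clm_apply contDiffOn_const

theorem hasDerivAt_snd (hD : IsOpen D) (hF : ContDiffOn ℝ ((n + 1 : ℕ) : ℕ∞) F (D ×ˢ D))
    {x y : V} {r : ℝ} (hx : x ∈ D) (hy : y + r • v ∈ D) :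
    HasDerivAt (fun r => F (x, y + r • v)) (fderiv ℝ F (x, y + r • v) (0, v)) r := by
  have h1 : HasFDerivAt F (fderiv ℝ F (x, y + r • v)) (x, y + r • v) :=
    ((hF.differentiableOn (by simp)).differentiableAt
      ((hD.prod hD).mem_nhds ⟨hx, hy⟩)).hasFDerivAt
  refine h1.comp_hasDerivAt r ((hasDerivAt_const r x).prodMk ?_)
  simpa using ((hasDerivAt_id r).smul_const v).const_add y

theorem hasDerivAt_fst (hD : IsOpen D) (hF : ContDiffOn ℝ ((n + 1 : ℕ) : ℕ∞) F (D ×ˢ D))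
    {x y : V} {r : ℝ} (hx : x + r • v ∈ D) (hy : y ∈ D) :
    HasDerivAt (fun r => F (x + r • v, y)) (fderiv ℝ F (x + r • v, y) (v, 0)) r := by
  have h1 : HasFDerivAt F (fderiv ℝ F (x + r • v, y)) (x + r • v, y) :=
    ((hF.differentiableOn (by simp)).differentiableAt
      ((hD.prod hD).mem_nhds ⟨hx, hy⟩)).hasFDerivAt
  refine h1.comp_hasDerivAt r (HasDerivAt.prodMk ?_ (hasDerivAt_const r y))
  simpa using ((hasDerivAt_id r).smul_const v).const_add x

end Directional

/-- The Gram kernel of `G` is of class `C^{2n+1}` on `D × D`. -/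
def HasSmoothGram (D : Set V) (n : ℕ) (G : V → H) : Prop :=
  ContDiffOn ℝ ((2 * n + 1 : ℕ) : ℕ∞) (fun p : V × V => ⟪G p.1, G p.2⟫_ℝ) (D ×ˢ D)

variable {D : Set V} {n : ℕ} {G : V → H}

theorem HasSmoothGram.continuousOn (h : HasSmoothGram D n G) : ContinuousOn G D :=
  continuousOn_of_continuousOn_inner (ContDiffOn.continuousOn h)

theorem HasSmoothGram.hasLineDerivAt [CompleteSpace H] (hD : IsOpen D)
    (h : HasSmoothGram D (n + 1) G) (v : V) {x : V} (hx : x ∈ D) :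
    HasLineDerivAt ℝ G (lineDeriv ℝ G x v) x v := by
  refine LineDifferentiableAt.hasLineDerivAt ?_
  have h0 : ContDiffOn ℝ (((2 * n + 1 + 1) + 1 : ℕ) : ℕ∞)
      (fun p : V × V => ⟪G p.1, G p.2⟫_ℝ) (D ×ˢ D) := h
  have h1 := contDiffOn_fderiv_apply hD h0 (0, v)
  have h2 := contDiffOn_fderiv_apply hD h1 (v, 0)
  have hmem : ∀ᶠ p in 𝓝 (0 : ℝ × ℝ), x + p.1 • v ∈ D ∧ x + p.2 • v ∈ D := by
    have hc1 : ContinuousAt (fun p : ℝ × ℝ => x + p.1 • v) 0 := by fun_prop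
    have hc2 : ContinuousAt (fun p : ℝ × ℝ => x + p.2 • v) 0 := by fun_prop
    exact (hc1.eventually (hD.mem_nhds (by simpa using hx))).and
      (hc2.eventually (hD.mem_nhds (by simpa using hx)))
  refine differentiableAt_of_mixed_deriv_inner (g := fun t => G (x + t • v))
    (a := fun t r => fderiv ℝ (fun p : V × V => ⟪G p.1, G p.2⟫_ℝ) (x + t • v, x + r • v) (0, v))
    (b := fun t r => fderiv ℝ (fun p => fderiv ℝ (fun p : V × V => ⟪G p.1, G p.2⟫_ℝ) p (0, v))
      (x + t • v, x + r • v) (v, 0)) ?_ ?_ ?_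
  · filter_upwards [hmem] with p hp
    exact hasDerivAt_snd hD h0 hp.1 hp.2
  · filter_upwards [hmem] with p hp
    exact hasDerivAt_fst hD h1 hp.1 hp.2
  · have h3 : ContinuousAt (fun q : V × V => fderiv ℝ
        (fun p => fderiv ℝ (fun p : V × V => ⟪G p.1, G p.2⟫_ℝ) p (0, v)) q (v, 0)) (x, x) :=
      h2.continuousOn.continuousAt ((hD.prod hD).mem_nhds ⟨hx, hx⟩)
    have hc : ContinuousAt (fun p : ℝ × ℝ => (x + p.1 • v, x + p.2 • v)) 0 := by fun_prop
    refine ContinuousAt.comp_of_eq h3 hc ?_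
    simp

/-- The Gram kernel of the derivative is the mixed derivative of the Gram kernel, one derivative in
each argument, so every differentiation of `G` costs two orders. -/
theorem HasSmoothGram.lineDeriv [CompleteSpace H] (hD : IsOpen D)
    (h : HasSmoothGram D (n + 1) G) (v : V) :
    HasSmoothGram D n (fun x => lineDeriv ℝ G x v) := by
  have h0 : ContDiffOn ℝ (((2 * n + 1 + 1) + 1 : ℕ) : ℕ∞)
      (fun p : V × V => ⟪G p.1, G p.2⟫_ℝ) (D ×ˢ D) := h
  have h1 := contDiffOn_fderiv_apply hD h0 (0, v)
  have h2 := contDiffOn_fderiv_apply hD h1 (v, 0)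
  have e1 : ∀ p ∈ D ×ˢ D, fderiv ℝ (fun p : V × V => ⟪G p.1, G p.2⟫_ℝ) p (0, v)
      = ⟪G p.1, _root_.lineDeriv ℝ G p.2 v⟫_ℝ := fun p hp => by
    have h3 := hasDerivAt_snd (v := v) (r := 0) hD h0 hp.1 (by simpa using hp.2)
    have h4 := (hasDerivAt_const (0 : ℝ) (G p.1)).inner ℝ (h.hasLineDerivAt hD v hp.2)
    simp only [zero_smul, add_zero, inner_zero_left] at h3 h4
    exact h3.unique h4
  refine ContDiffOn.congr h2 fun p hp => ?_
  have h3 := hasDerivAt_fst (v := v) (r := 0) hD h1 (by simpa using hp.1) hp.2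
  have h4 := (h.hasLineDerivAt hD v hp.1).inner ℝ
    (hasDerivAt_const (0 : ℝ) (_root_.lineDeriv ℝ G p.2 v))
  simp only [zero_smul, add_zero, inner_zero_right, zero_add] at h3 h4
  refine (h3.unique (h4.congr_of_eventuallyEq ?_)).symm
  have hc : ContinuousAt (fun t : ℝ => p.1 + t • v) 0 := by fun_prop
  filter_upwards [hc.eventually (hD.mem_nhds (by simpa using hp.1))] with t ht
  exact e1 (p.1 + t • v, p.2) ⟨ht, hp.2⟩

end FeatureMap

/-! ### Higher derivatives of the feature map -/

section IteratedFeature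

variable {d : ℕ} {H : Type*} [NormedAddCommGroup H] [InnerProductSpace ℝ H]

/-- The first order partial derivative of a function with values in `H`. -/
def featurePderiv (i : Fin d) (G : EuclideanSpace ℝ (Fin d) → H) :
    EuclideanSpace ℝ (Fin d) → H :=
  fun x => lineDeriv ℝ G x (EuclideanSpace.single i 1)

/-- The partial derivative of multi-index `α` of a function with values in `H`. -/
def featureDeriv (α : Fin d → ℕ) (G : EuclideanSpace ℝ (Fin d) → H) :
    EuclideanSpace ℝ (Fin d) → H :=
  (List.finRange d).foldr (fun i g => (featurePderiv i)^[α i] g) G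

/-- On `D`, the function `f` is the pairing of the feature map `G` with `u`. -/
def Represents (D : Set (EuclideanSpace ℝ (Fin d))) (G : EuclideanSpace ℝ (Fin d) → H) (u : H)
    (f : EuclideanSpace ℝ (Fin d) → ℝ) : Prop :=
  ∀ x ∈ D, f x = ⟪G x, u⟫_ℝ

theorem featureDeriv_zero (G : EuclideanSpace ℝ (Fin d) → H) : featureDeriv 0 G = G := by
  unfold featureDeriv
  induction List.finRange d with
  | nil => rfl
  | cons i l ih => simp

variable [CompleteSpace H] {D : Set (EuclideanSpace ℝ (Fin d))} {n : ℕ}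
  {G : EuclideanSpace ℝ (Fin d) → H}

theorem Represents.pderiv (hD : IsOpen D) (hG : HasSmoothGram D (n + 1) G) {u : H}
    {f : EuclideanSpace ℝ (Fin d) → ℝ} (hf : Represents D G u f) (i : Fin d) :
    Represents D (featurePderiv i G) u (PDEKernel.pderiv i f) := by
  intro x hx
  have h1 := (hG.hasLineDerivAt hD (EuclideanSpace.single i 1) hx).inner ℝ
    (hasDerivAt_const (0 : ℝ) u)
  simp only [inner_zero_right, zero_add] at h1
  have h2 : HasLineDerivAt ℝ (fun y => ⟪G y, u⟫_ℝ) ⟪featurePderiv i G x, u⟫_ℝ x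
      (EuclideanSpace.single i 1) := h1
  refine (h2.congr_of_eventuallyEq ?_).lineDeriv
  filter_upwards [hD.mem_nhds hx] with y hy using hf y hy

/-- Smoothness and pairing are carried together, because moving a derivative inside the pairing
needs the smoothness left at that stage. -/
theorem HasSmoothGram.iterate (hD : IsOpen D) (i : Fin d) (k : ℕ) {n : ℕ}
    (hG : HasSmoothGram D (n + k) G) :
    HasSmoothGram D n ((featurePderiv i)^[k] G) ∧ ∀ u f, Represents D G u f →
      Represents D ((featurePderiv i)^[k] G) u ((PDEKernel.pderiv i)^[k] f) := by
  induction k generalizing n with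
  | zero => exact ⟨hG, fun u f hf => hf⟩
  | succ k ih =>
    obtain ⟨h1, h2⟩ := ih (n := n + 1) (by rwa [add_assoc, add_comm 1 k])
    simp only [Function.iterate_succ_apply']
    exact ⟨h1.lineDeriv hD _, fun u f hf => (h2 u f hf).pderiv hD h1 i⟩

theorem HasSmoothGram.foldr (hD : IsOpen D) (α : Fin d → ℕ) (l : List (Fin d)) {n : ℕ}
    (hG : HasSmoothGram D (n + (l.map α).sum) G) :
    HasSmoothGram D n (l.foldr (fun i g => (featurePderiv i)^[α i] g) G) ∧
      ∀ u f, Represents D G u f →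
        Represents D (l.foldr (fun i g => (featurePderiv i)^[α i] g) G) u
          (l.foldr (fun i g => (PDEKernel.pderiv i)^[α i] g) f) := by
  induction l generalizing n with
  | nil => exact ⟨by simpa using hG, fun u f hf => hf⟩
  | cons i l ih =>
    obtain ⟨h1, h2⟩ := ih (n := n + α i) (by simpa [add_assoc] using hG)
    obtain ⟨h3, h4⟩ := h1.iterate hD i (α i)
    exact ⟨h3, fun u f hf => h4 u _ (h2 u f hf)⟩

theorem HasSmoothGram.featureDeriv (hD : IsOpen D) {s : ℕ} (hG : HasSmoothGram D s G)
    {α : Fin d → ℕ} (hα : ∑ i, α i ≤ s) :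
    HasSmoothGram D (s - ∑ i, α i) (featureDeriv α G) := by
  refine (HasSmoothGram.foldr hD α (List.finRange d) ?_).1
  rwa [← Fin.sum_univ_def, Nat.sub_add_cancel hα]

theorem Represents.partialDeriv (hD : IsOpen D) {s : ℕ} (hG : HasSmoothGram D s G)
    {α : Fin d → ℕ} (hα : ∑ i, α i ≤ s) {u : H} {f : EuclideanSpace ℝ (Fin d) → ℝ}
    (hf : Represents D G u f) :
    Represents D (PDEKernel.featureDeriv α G) u (PDEKernel.partialDeriv α f) := by
  refine (HasSmoothGram.foldr (n := s - ∑ i, α i) hD α (List.finRange d) ?_).2 u f hf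
  rwa [← Fin.sum_univ_def, Nat.sub_add_cancel hα]

end IteratedFeature

theorem partialDeriv_zero {d : ℕ} (f : EuclideanSpace ℝ (Fin d) → ℝ) : partialDeriv 0 f = f := by
  unfold partialDeriv
  induction List.finRange d with
  | nil => rfl
  | cons i l ih => simp

/-- Stars and bars: the slack `s - |α|` serves as an extra coordinate, giving `d + 1` parts of total
`s`. -/
theorem card_multiIndices_le (d s : ℕ) : (multiIndices d s).card ≤ (d + s).choose d := by
  have h : (Finset.finsuppAntidiag (Finset.univ : Finset (Fin (d + 1))) s).card
      = (d + s).choose d := by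
    rw [Finset.card_finsuppAntidiag_nat_eq_choose, Finset.card_univ, Fintype.card_fin,
      show d + 1 + s - 1 = d + s by omega, Nat.choose_symm_add]
  rw [← h]
  refine Finset.card_le_card_of_injOn
    (fun α => Finsupp.equivFunOnFinite.symm (Fin.cons (s - ∑ i, α i) α : Fin (d + 1) → ℕ)) ?_ ?_
  · intro α hα
    have hα' := (mem_multiIndices α).1 hα
    simp [Finset.mem_finsuppAntidiag, Fin.sum_univ_succ, hα']
  · intro α _ β _ hαβ
    have h1 := Finsupp.equivFunOnFinite.symm.injective hαβ
    exact (Fin.cons_inj.1 h1).2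

/-! ### The representer of `P_s` in the kernel space, its bound and measurability -/

section Kernel

variable {d : ℕ} {D : Set (EuclideanSpace ℝ (Fin d))} {K : closure D → closure D → ℝ}

theorem extendZero_apply (u : closure D → ℝ) (x : closure D) :
    extendZero D u (x : EuclideanSpace ℝ (Fin d)) = u x :=
  Subtype.val_injective.extend_apply u 0 x

theorem abs_mixedDeriv_le_cbNorm {k m : ℕ} (hK : IsCb D m K) (hkm : k ≤ m) {α β : Fin d → ℕ}
    (hαβ : ∑ i, α i + ∑ i, β i ≤ k) {x y : EuclideanSpace ℝ (Fin d)} (hx : x ∈ D) (hy : y ∈ D) :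
    |mixedDeriv D K α β x y| ≤ cbNorm D k K := by
  -- The supremum is meaningful only for a set bounded above; this holds because finitely many pairs
  -- of multi-indices occur, each with its own bound.
  refine le_csSup ?_ ⟨α, β, hαβ, x, hx, y, hy, rfl⟩
  have hM : ∀ p : (Fin d → ℕ) × (Fin d → ℕ), ∃ M : ℝ, ∑ i, p.1 i + ∑ i, p.2 i ≤ k →
      ∀ x ∈ D, ∀ y ∈ D, |mixedDeriv D K p.1 p.2 x y| ≤ M := fun p => by
    by_cases hp : ∑ i, p.1 i + ∑ i, p.2 i ≤ k
    · obtain ⟨M, hM⟩ := hK.bounded p.1 p.2 (hp.trans hkm)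
      exact ⟨M, fun _ => hM⟩
    · exact ⟨0, fun h => absurd h hp⟩
  choose M hM using hM
  obtain ⟨B, hB⟩ := ((multiIndices d k ×ˢ multiIndices d k).image M).finite_toSet.bddAbove
  refine ⟨B, ?_⟩
  rintro _ ⟨α', β', h, x', hx', y', hy', rfl⟩
  refine (hM (α', β') h x' hx' y' hy').trans (hB ?_)
  refine Finset.mem_coe.2 (Finset.mem_image_of_mem M (Finset.mem_product.2 ⟨?_, ?_⟩))
  · exact (mem_multiIndices _).2 (by show ∑ i, α' i ≤ k; omega)
  · exact (mem_multiIndices _).2 (by show ∑ i, β' i ≤ k; omega)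

variable (H : Type*) [NormedAddCommGroup H] [InnerProductSpace ℝ H] [CompleteSpace H]
  [RKHS ℝ H (closure D) ℝ]

open Classical in
variable (D) in
/-- The canonical feature map `x ↦ K_x`, extended by `0` to the whole space. -/
def feature (x : EuclideanSpace ℝ (Fin d)) : H :=
  if h : x ∈ closure D then RKHS.kerFun H (⟨x, h⟩ : closure D) 1 else 0

theorem feature_coe (x : closure D) : feature D H x = RKHS.kerFun H x 1 := by
  simp [feature]

variable {H}

theorem inner_feature (x : closure D) (u : H) : ⟪feature D H x, u⟫_ℝ = u x := by
  rw [feature_coe, RKHS.kerFun_inner]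
  simp

theorem inner_feature_feature (hH : ∀ x y, RKHS.kernel H x y 1 = K x y) (x y : closure D) :
    ⟪feature D H x, feature D H y⟫_ℝ = K x y := by
  rw [inner_feature, feature_coe, RKHS.kerFun_apply, hH]

theorem extendKernel_eq_inner (hH : ∀ x y, RKHS.kernel H x y 1 = K x y) (x y : closure D) :
    extendKernel D K x y = ⟪feature D H x, feature D H y⟫_ℝ := by
  rw [inner_feature_feature hH, extendKernel, extendZero_apply, extendZero_apply]

theorem hasSmoothGram_feature {s : ℕ} (hKs : IsCb D (2 * s + 1) K)
    (hH : ∀ x y, RKHS.kernel H x y 1 = K x y) : HasSmoothGram D s (feature D H) :=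
  hKs.contDiffOn.congr fun p hp =>
    (extendKernel_eq_inner hH ⟨p.1, subset_closure hp.1⟩ ⟨p.2, subset_closure hp.2⟩).symm

theorem represents_extendZero (u : H) : Represents D (feature D H) u (extendZero D u) :=
  fun x hx => by
    have := inner_feature ⟨x, subset_closure hx⟩ u
    rw [this]
    exact extendZero_apply (u : closure D → ℝ) ⟨x, subset_closure hx⟩

/-- The pairing rule is used twice: in `y` against the fixed vector `K_{x'}`, then in `x'` against
the fixed vector `∂^β K_y`. -/
theorem mixedDeriv_eq_inner (hD : IsOpen D) {s : ℕ} (hKs : IsCb D (2 * s + 1) K)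
    (hH : ∀ x y, RKHS.kernel H x y 1 = K x y) {α β : Fin d → ℕ} (hα : ∑ i, α i ≤ s)
    (hβ : ∑ i, β i ≤ s) {x y : EuclideanSpace ℝ (Fin d)} (hx : x ∈ D) (hy : y ∈ D) :
    mixedDeriv D K α β x y
      = ⟪featureDeriv α (feature D H) x, featureDeriv β (feature D H) y⟫_ℝ := by
  have hG := hasSmoothGram_feature hKs hH
  refine Represents.partialDeriv hD hG hα (fun x' hx' => ?_) x hx
  rw [real_inner_comm]
  refine Represents.partialDeriv hD hG hβ (fun y' hy' => ?_) y hy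
  rw [real_inner_comm]
  exact extendKernel_eq_inner hH ⟨x', subset_closure hx'⟩ ⟨y', subset_closure hy'⟩

/-- The squared norm is the mixed derivative with `β = α` on the diagonal, of order at most `2 s`.
-/
theorem norm_featureDeriv_le_kappa (hD : IsOpen D) {s : ℕ} (hKs : IsCb D (2 * s + 1) K)
    (hH : ∀ x y, RKHS.kernel H x y 1 = K x y) {α : Fin d → ℕ} (hα : ∑ i, α i ≤ s)
    {x : EuclideanSpace ℝ (Fin d)} (hx : x ∈ D) :
    ‖featureDeriv α (feature D H) x‖ ≤ kappa D s K := by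
  refine Real.le_sqrt_of_sq_le ?_
  rw [← real_inner_self_eq_norm_sq, ← mixedDeriv_eq_inner hD hKs hH hα hα hx hx]
  exact (le_abs_self _).trans (abs_mixedDeriv_le_cbNorm hKs (by omega) (by omega) hx hx)

theorem continuous_feature_coe (hK : IsMercerKernel D K)
    (hH : ∀ x y, RKHS.kernel H x y 1 = K x y) :
    Continuous fun x : closure D => feature D H x := by
  rw [← continuousOn_univ]
  refine continuousOn_of_continuousOn_inner ?_
  simp only [inner_feature_feature hH]
  exact hK.continuous.continuousOn

/-- Boundary points are reached by density of `D` in its closure and continuity of the feature map.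
-/
theorem norm_feature_le_kappa (hD : IsOpen D) {s : ℕ} (hK : IsMercerKernel D K)
    (hKs : IsCb D (2 * s + 1) K) (hH : ∀ x y, RKHS.kernel H x y 1 = K x y) (x : closure D) :
    ‖feature D H x‖ ≤ kappa D s K := by
  have hcl : IsClosed {x : closure D | ‖feature D H x‖ ≤ kappa D s K} :=
    isClosed_le (continuous_feature_coe hK hH).norm continuous_const
  have hx : x ∈ closure {x : closure D | (x : EuclideanSpace ℝ (Fin d)) ∈ D} := by
    rw [closure_subtype]
    convert x.2
    ext y
    simp only [Set.mem_image, Set.mem_ofPred_eq, Subtype.exists, exists_and_left, exists_prop,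
      exists_eq_right_right]
    exact ⟨fun h => h.1, fun h => ⟨h, subset_closure h⟩⟩
  refine hcl.closure_subset_iff.2 (fun y hy => ?_) hx
  have h := norm_featureDeriv_le_kappa (H := H) hD hKs hH (α := 0) (by simp) hy
  rwa [featureDeriv_zero] at h

/-- The vector of the space `H` that represents the functional `u ↦ P_s u (x)`. -/
def representer (D : Set (EuclideanSpace ℝ (Fin d))) (s : ℕ)
    (φ : (Fin d → ℕ) → EuclideanSpace ℝ (Fin d) → ℝ) (H : Type*) [NormedAddCommGroup H]
    [InnerProductSpace ℝ H] [CompleteSpace H] [RKHS ℝ H (closure D) ℝ] (x : closure D) : H :=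
  ∑ α ∈ multiIndices d s, coeff D φ α x • featureDeriv α (feature D H) x

variable {s : ℕ} {φ : (Fin d → ℕ) → EuclideanSpace ℝ (Fin d) → ℝ}

theorem coeff_of_notMem {α : Fin d → ℕ} (hα : α ≠ 0) {x : closure D}
    (hx : (x : EuclideanSpace ℝ (Fin d)) ∉ D) : coeff D φ α x = 0 := by
  simp [coeff, hx, hα]

/-- On the boundary, the derivatives of the zero extensions carry no meaning, but only `α = 0` has a
nonzero coefficient there, and it gives the reproducing property. -/
theorem applyP_eq_inner (hD : IsOpen D) (hKs : IsCb D (2 * s + 1) K)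
    (hH : ∀ x y, RKHS.kernel H x y 1 = K x y) (u : H) (x : closure D) :
    applyP D s φ u x = ⟪representer D s φ H x, u⟫_ℝ := by
  rw [applyP, representer, sum_inner]
  refine Finset.sum_congr rfl fun α hα => ?_
  rw [inner_smul_left, conj_trivial]
  by_cases hx : (x : EuclideanSpace ℝ (Fin d)) ∈ D
  · rw [(represents_extendZero u).partialDeriv hD (hasSmoothGram_feature hKs hH)
      ((mem_multiIndices α).1 hα) x hx]
  · rcases eq_or_ne α 0 with rfl | h0
    · rw [partialDeriv_zero, featureDeriv_zero, inner_feature, extendZero_apply]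
    · rw [coeff_of_notMem h0 hx, zero_mul, zero_mul]

variable {μ : Measure (closure D)}

theorem ae_norm_representer_le (hD : IsOpen D) (hK : IsMercerKernel D K)
    (hKs : IsCb D (2 * s + 1) K) (hH : ∀ x y, RKHS.kernel H x y 1 = K x y) {C : ℝ} (hC0 : 0 ≤ C)
    (hC : ∀ α ∈ multiIndices d s, ∀ᵐ x ∂μ, |coeff D φ α x| ≤ C) :
    ∀ᵐ x ∂μ, ‖representer D s φ H x‖ ≤ (d + s).choose d * C * kappa D s K := by
  have hκ : 0 ≤ kappa D s K := Real.sqrt_nonneg _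
  filter_upwards [(Filter.eventually_all_finset _).2 hC] with x hx
  have hterm : ∀ α ∈ multiIndices d s,
      ‖coeff D φ α x • featureDeriv α (feature D H) x‖ ≤ C * kappa D s K := fun α hα => by
    rw [norm_smul, Real.norm_eq_abs]
    by_cases hxD : (x : EuclideanSpace ℝ (Fin d)) ∈ D
    · exact mul_le_mul (hx α hα)
        (norm_featureDeriv_le_kappa hD hKs hH ((mem_multiIndices α).1 hα) hxD)
        (norm_nonneg _) hC0
    · rcases eq_or_ne α 0 with rfl | h0
      · rw [featureDeriv_zero]
        exact mul_le_mul (hx _ hα) (norm_feature_le_kappa hD hK hKs hH x) (norm_nonneg _) hC0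
      · rw [coeff_of_notMem h0 hxD, abs_zero, zero_mul]
        positivity
  refine (norm_sum_le_of_le _ hterm).trans ?_
  rw [Finset.sum_const, nsmul_eq_mul, mul_assoc]
  gcongr
  exact card_multiIndices_le d s

theorem aestronglyMeasurable_representer (hD : IsOpen D) (hK : IsMercerKernel D K)
    (hKs : IsCb D (2 * s + 1) K) (hH : ∀ x y, RKHS.kernel H x y 1 = K x y)
    (hφ : ∀ α ∈ multiIndices d s, AEMeasurable (coeff D φ α) μ) :
    AEStronglyMeasurable (representer D s φ H) μ := by
  unfold representer
  refine Finset.aestronglyMeasurable_fun_sum _ fun α hα => ?_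
  rcases eq_or_ne α 0 with rfl | h0
  · simp only [featureDeriv_zero]
    exact (hφ _ hα).aestronglyMeasurable.smul
      (continuous_feature_coe hK hH).aestronglyMeasurable
  · have hS : MeasurableSet {x : closure D | (x : EuclideanSpace ℝ (Fin d)) ∈ D} :=
      (hD.preimage continuous_subtype_val).measurableSet
    have hcont : ContinuousOn (fun x : closure D => featureDeriv α (feature D H) x)
        {x : closure D | (x : EuclideanSpace ℝ (Fin d)) ∈ D} :=
      ((hasSmoothGram_feature hKs hH).featureDeriv hD
        ((mem_multiIndices α).1 hα)).continuousOn.comp continuous_subtype_val.continuousOn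
        fun x hx => hx
    -- Continuity of the derivative is known only on `D`; the cut-off to `D` is harmless because the
    -- coefficient vanishes elsewhere.
    have hind : AEStronglyMeasurable
        ({x : closure D | (x : EuclideanSpace ℝ (Fin d)) ∈ D}.indicator
          fun x : closure D => featureDeriv α (feature D H) x) μ :=
      (aestronglyMeasurable_indicator_iff hS).2 (hcont.aestronglyMeasurable hS)
    refine ((hφ α hα).aestronglyMeasurable.smul hind).congr (Filter.Eventually.of_forall fun x => ?_)
    by_cases hx : (x : EuclideanSpace ℝ (Fin d)) ∈ D
    · simp [hx]
    · simp [coeff_of_notMem h0 hx]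

end Kernel

/-! ### The operators `P_s` and `P_{s,N}` and their normal operators -/

section Operators

variable {d : ℕ} {D : Set (EuclideanSpace ℝ (Fin d))} {s : ℕ}
  {φ : (Fin d → ℕ) → EuclideanSpace ℝ (Fin d) → ℝ}
  {H : Type*} [NormedAddCommGroup H] [InnerProductSpace ℝ H]
  [RKHS ℝ H (closure D) ℝ] {ψ : closure D → H}

theorem toOperator_apply {V W : Type*} [NormedAddCommGroup V] [NormedSpace ℝ V]
    [NormedAddCommGroup W] [NormedSpace ℝ W] {F : V → W} (hF : IsBoundedLinearMap ℝ F) (v : V) :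
    toOperator F v = F v := by
  rw [toOperator, dif_pos hF]
  rfl

theorem isBoundedLinearMap_mapSample
    (hψ : ∀ (v : H) x, applyP D s φ v x = ⟪ψ x, v⟫_ℝ) {N : ℕ} (x : Fin N → closure D) :
    IsBoundedLinearMap ℝ (mapSample D s φ H x) := by
  let T : H →L[ℝ] EuclideanSpace ℝ (Fin N) :=
    (EuclideanSpace.equiv (Fin N) ℝ).symm.toContinuousLinearMap ∘L
      ContinuousLinearMap.pi fun i => (√(N : ℝ))⁻¹ • innerSL ℝ (ψ (x i))
  have hT : mapSample D s φ H x = T := by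
    funext v
    ext i
    simp [mapSample, T, hψ]
  rw [hT]
  exact T.isBoundedLinearMap

theorem adjoint_opSample_apply [CompleteSpace H]
    (hψ : ∀ (v : H) x, applyP D s φ v x = ⟪ψ x, v⟫_ℝ) {N : ℕ}
    (x : Fin N → closure D) (w : H) :
    (opSample D s φ H x).adjoint (opSample D s φ H x w)
      = (N : ℝ)⁻¹ • ∑ i, ⟪ψ (x i), w⟫_ℝ • ψ (x i) := by
  refine ext_inner_right ℝ fun v => ?_
  rw [ContinuousLinearMap.adjoint_inner_left, opSample,
    toOperator_apply (isBoundedLinearMap_mapSample hψ x),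
    toOperator_apply (isBoundedLinearMap_mapSample hψ x), inner_smul_left, sum_inner,
    Finset.mul_sum, PiLp.inner_apply]
  refine Finset.sum_congr rfl fun i _ => ?_
  simp only [mapSample, hψ, inner_smul_left, conj_trivial]
  have h : (N : ℝ)⁻¹ = (√(N : ℝ))⁻¹ * (√(N : ℝ))⁻¹ := by
    rw [← mul_inv, Real.mul_self_sqrt (Nat.cast_nonneg N)]
  rw [h]
  simp
  ring

variable {μ : Measure (closure D)} {R : ℝ}

theorem ae_abs_applyP_le (hψ : ∀ (v : H) x, applyP D s φ v x = ⟪ψ x, v⟫_ℝ)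
    (hR : ∀ᵐ x ∂μ, ‖ψ x‖ ≤ R) (v : H) : ∀ᵐ x ∂μ, ‖applyP D s φ v x‖ ≤ R * ‖v‖ := by
  filter_upwards [hR] with x hx
  rw [hψ]
  exact (norm_inner_le_norm _ _).trans (by gcongr)

theorem mapL2_eq_toLp {v : H} (hv : MemLp (applyP D s φ v) 2 μ) :
    mapL2 D s φ H μ v = hv.toLp _ := dif_pos hv

variable [IsProbabilityMeasure μ]

theorem memLp_applyP (hψ : ∀ (v : H) x, applyP D s φ v x = ⟪ψ x, v⟫_ℝ)
    (hm : AEStronglyMeasurable ψ μ) (hR : ∀ᵐ x ∂μ, ‖ψ x‖ ≤ R) (v : H) :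
    MemLp (applyP D s φ v) 2 μ := by
  refine MemLp.of_bound ?_ (R * ‖v‖) (ae_abs_applyP_le hψ hR v)
  have : applyP D s φ v = fun x => ⟪ψ x, v⟫_ℝ := funext (hψ v)
  rw [this]
  exact hm.inner aestronglyMeasurable_const

theorem isBoundedLinearMap_mapL2 (hψ : ∀ (v : H) x, applyP D s φ v x = ⟪ψ x, v⟫_ℝ)
    (hm : AEStronglyMeasurable ψ μ) (hR : ∀ᵐ x ∂μ, ‖ψ x‖ ≤ R) (hR0 : 0 ≤ R) :
    IsBoundedLinearMap ℝ (mapL2 D s φ H μ) := by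
  have hmem := memLp_applyP hψ hm hR
  refine IsLinearMap.with_bound ⟨fun u v => ?_, fun c v => ?_⟩ R fun v => ?_
  · rw [mapL2_eq_toLp (hmem u), mapL2_eq_toLp (hmem v), mapL2_eq_toLp (hmem (u + v)),
      ← MemLp.toLp_add]
    congr 1
    funext x
    simp only [Pi.add_apply, hψ, inner_add_right]
  · rw [mapL2_eq_toLp (hmem v), mapL2_eq_toLp (hmem (c • v)), ← MemLp.toLp_const_smul]
    congr 1
    funext x
    simp only [Pi.smul_apply, hψ, inner_smul_right, smul_eq_mul]
  · rw [mapL2_eq_toLp (hmem v)]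
    refine (Lp.norm_le_of_ae_bound (C := R * ‖v‖) (by positivity) ?_).trans (by simp [measureUnivNNReal])
    filter_upwards [(hmem v).coeFn_toLp, ae_abs_applyP_le hψ hR v] with x h1 h2
    rwa [h1]

theorem adjoint_opL2_apply [CompleteSpace H] (hψ : ∀ (v : H) x, applyP D s φ v x = ⟪ψ x, v⟫_ℝ)
    (hm : AEStronglyMeasurable ψ μ) (hR : ∀ᵐ x ∂μ, ‖ψ x‖ ≤ R) (hR0 : 0 ≤ R) (w : H) :
    (opL2 D s φ H μ).adjoint (opL2 D s φ H μ w) = ∫ x, ⟪ψ x, w⟫_ℝ • ψ x ∂μ := by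
  have hmem := memLp_applyP hψ hm hR
  have hb := isBoundedLinearMap_mapL2 hψ hm hR hR0
  have hint : Integrable (fun x => ⟪ψ x, w⟫_ℝ • ψ x) μ := by
    refine Integrable.of_bound ((hm.inner aestronglyMeasurable_const).smul hm) (R * ‖w‖ * R) ?_
    filter_upwards [hR] with x hx
    rw [norm_smul]
    gcongr
    exact (norm_inner_le_norm _ _).trans (by gcongr)
  refine ext_inner_left ℝ fun v => ?_
  rw [ContinuousLinearMap.adjoint_inner_right, opL2, toOperator_apply hb, toOperator_apply hb,
    mapL2_eq_toLp (hmem v), mapL2_eq_toLp (hmem w), L2.inner_def, ← integral_inner hint]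
  refine integral_congr_ae ?_
  filter_upwards [(hmem v).coeFn_toLp, (hmem w).coeFn_toLp] with x h1 h2
  rw [h1, h2, hψ, hψ, inner_smul_right, real_inner_comm (ψ x) v]
  simp

end Operators

end PDEKernel

end

/-! ### The estimation error bound -/

theorem proposition3p1 {d s N : ℕ} (hN : 0 < N)
    {D : Set (EuclideanSpace ℝ (Fin d))} (hD : IsOpen D)
    (φ : (Fin d → ℕ) → EuclideanSpace ℝ (Fin d) → ℝ)
    (K : closure D → closure D → ℝ)
    (hK : PDEKernel.IsMercerKernel D K) (hKs : PDEKernel.IsCb D (2 * s + 1) K)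
    {H : Type*} [NormedAddCommGroup H] [InnerProductSpace ℝ H] [CompleteSpace H]
    [RKHS ℝ H (closure D) ℝ] (hH : ∀ x y, RKHS.kernel H x y 1 = K x y)
    (μ : Measure (closure D)) [IsProbabilityMeasure μ]
    (hφ : ∀ α ∈ PDEKernel.multiIndices d s, AEMeasurable (PDEKernel.coeff D φ α) μ)
    (C : ℝ) (hC : ∀ α ∈ PDEKernel.multiIndices d s, ∀ᵐ x ∂μ, |PDEKernel.coeff D φ α x| ≤ C)
    {Ω : Type*} [MeasurableSpace Ω] (P : Measure Ω)
    [IsProbabilityMeasure P] (X : Fin N → Ω → closure D)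
    (hX : ∀ i, HasLaw (X i) μ P) (hXind : iIndepFun X P)
    {lam : ℝ} (hlam : 0 < lam) (h : closure D → ℝ) (hh : MemLp h 2 μ)
    (u : H) (hu : PDEKernel.applyP D s φ u =ᵐ[μ] h)
    {δ : ℝ} (hδ : 0 < δ) (hδ1 : δ < 1) :
    (∀ v : H, MemLp (PDEKernel.applyP D s φ v) 2 μ) ∧
    IsBoundedLinearMap ℝ (PDEKernel.mapL2 D s φ H μ) ∧
    (∀ x : Fin N → closure D, IsBoundedLinearMap ℝ (PDEKernel.mapSample D s φ H x)) ∧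
    ENNReal.ofReal (1 - δ) ≤ P {ω |
      ‖PDEKernel.empEstimator D s φ H (fun i => X i ω) lam h
          - PDEKernel.statEstimator D s φ H μ lam (hh.toLp h)‖
        ≤ (√(8 * Real.log (2 / δ) / N) + 1) * √(2 * Real.log (2 / δ) / (N * lam ^ 2))
          * ((d + s).choose d * C * PDEKernel.kappa D s K) ^ 2 * ‖u‖
          * (1 + (d + s).choose d * PDEKernel.kappa D s K * C / √lam)} := by
  set R : ℝ := (d + s).choose d * C * PDEKernel.kappa D s K with hRdef
  have h0 : (0 : Fin d → ℕ) ∈ PDEKernel.multiIndices d s :=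
    (PDEKernel.mem_multiIndices _).2 (by simp)
  -- A probability measure is nonzero, so the almost everywhere bound holds at some point, which
  -- forces `C ≥ 0`.
  obtain ⟨x₀, hx₀⟩ := (hC 0 h0).exists
  have hC0 : 0 ≤ C := (abs_nonneg _).trans hx₀
  have hκ : 0 ≤ PDEKernel.kappa D s K := Real.sqrt_nonneg _
  have hR0 : 0 ≤ R := by positivity
  set ψ := PDEKernel.representer D s φ H with hψdef
  have hψ : ∀ (v : H) x, PDEKernel.applyP D s φ v x = ⟪ψ x, v⟫_ℝ := fun v x =>
    PDEKernel.applyP_eq_inner hD hKs hH v x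
  have hm : AEStronglyMeasurable ψ μ :=
    PDEKernel.aestronglyMeasurable_representer hD hK hKs hH hφ
  have hR : ∀ᵐ x ∂μ, ‖ψ x‖ ≤ R := PDEKernel.ae_norm_representer_le hD hK hKs hH hC0 hC
  have hmem := PDEKernel.memLp_applyP hψ hm hR
  have hb := PDEKernel.isBoundedLinearMap_mapL2 hψ hm hR hR0
  refine ⟨hmem, hb, PDEKernel.isBoundedLinearMap_mapSample hψ, ?_⟩
  set w : H := Ring.inverse (PDEKernel.regularized (PDEKernel.opL2 D s φ H μ) lam) u with hw
  have hwu : ‖w‖ ≤ ‖u‖ / lam := by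
    rw [le_div_iff₀ hlam, mul_comm]
    exact PDEKernel.norm_inverse_regularized_le _ hlam u
  have hξm : AEStronglyMeasurable (fun x => ⟪ψ x, w⟫_ℝ • ψ x) μ :=
    (hm.inner aestronglyMeasurable_const).smul hm
  have hξb : ∀ᵐ x ∂μ, ‖⟪ψ x, w⟫_ℝ • ψ x‖ ≤ R ^ 2 * (‖u‖ / lam) := by
    filter_upwards [hR] with x hx
    rw [norm_smul]
    calc ‖⟪ψ x, w⟫_ℝ‖ * ‖ψ x‖ ≤ (R * (‖u‖ / lam)) * R := by
          gcongr
          exact (norm_inner_le_norm _ _).trans (by gcongr)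
      _ = _ := by ring
  refine (PDEKernel.prob_norm_mean_sub_integral_le hN hX hXind hξm hξb (by positivity) hδ
    hδ1).trans (measure_mono_ae ?_)
  have hL2 : hh.toLp h = PDEKernel.opL2 D s φ H μ u := by
    rw [PDEKernel.opL2, PDEKernel.toOperator_apply hb, PDEKernel.mapL2_eq_toLp (hmem u)]
    exact (MemLp.toLp_eq_toLp_iff _ _).2 hu.symm
  -- Almost surely no sample point meets the null set where `P_s u ≠ h`, so the data are exactly
  -- those of `u`.
  have hsample : ∀ᵐ ω ∂P, ∀ i, PDEKernel.applyP D s φ u (X i ω) = h (X i ω) := by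
    refine ae_all_iff.2 fun i => ?_
    have h1 : ∀ᵐ x ∂(P.map (X i)), PDEKernel.applyP D s φ u x = h x := by
      rw [(hX i).map_eq]
      exact hu
    exact ae_of_ae_map (hX i).aemeasurable h1
  filter_upwards [hsample] with ω hω hωb
  have hωb' : ‖(N : ℝ)⁻¹ • ∑ i, ⟪ψ (X i ω), w⟫_ℝ • ψ (X i ω) - ∫ x, ⟪ψ x, w⟫_ℝ • ψ x ∂μ‖
      ≤ (√(8 * Real.log (2 / δ) / N) + 1) * √(2 * Real.log (2 / δ) / N)
        * (R ^ 2 * (‖u‖ / lam)) := hωb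
  have hemp : PDEKernel.empEstimator D s φ H (fun i => X i ω) lam h
      = Ring.inverse (PDEKernel.regularized (PDEKernel.opSample D s φ H fun i => X i ω) lam)
        ((PDEKernel.opSample D s φ H fun i => X i ω).adjoint
          (PDEKernel.opSample D s φ H (fun i => X i ω) u)) := by
    have h1 : PDEKernel.opSample D s φ H (fun i => X i ω) u
        = (√(N : ℝ))⁻¹ • WithLp.toLp 2 fun i => h (X i ω) := by
      rw [PDEKernel.opSample,
        PDEKernel.toOperator_apply (PDEKernel.isBoundedLinearMap_mapSample hψ _)]
      ext i
      simp [PDEKernel.mapSample, hω]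
    rw [h1, map_smul, map_smul, PDEKernel.empEstimator]
  have hstat : PDEKernel.statEstimator D s φ H μ lam (hh.toLp h)
      = Ring.inverse (PDEKernel.regularized (PDEKernel.opL2 D s φ H μ) lam)
        ((PDEKernel.opL2 D s φ H μ).adjoint (PDEKernel.opL2 D s φ H μ u)) := by
    rw [PDEKernel.statEstimator, hL2]
  have herr := PDEKernel.norm_tikhonov_sub_tikhonov_le (PDEKernel.opL2 D s φ H μ)
    (PDEKernel.opSample D s φ H fun i => X i ω) hlam u
  rw [← hemp, ← hstat, ← hw, PDEKernel.adjoint_opSample_apply hψ,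
    PDEKernel.adjoint_opL2_apply hψ hm hR hR0] at herr
  refine (herr.trans hωb').trans ?_
  have hsqrt : √(2 * Real.log (2 / δ) / (N * lam ^ 2)) = √(2 * Real.log (2 / δ) / N) / lam := by
    rw [← div_div, Real.sqrt_div' _ (sq_nonneg lam), Real.sqrt_sq hlam.le]
  rw [hsqrt]
  -- The bound obtained so far is the claim without its last factor, which is at least `1`.
  have h1 : (1 : ℝ) ≤ 1 + (d + s).choose d * PDEKernel.kappa D s K * C / √lam :=
    le_add_of_nonneg_right (by positivity)
  calc _ = (√(8 * Real.log (2 / δ) / N) + 1) * (√(2 * Real.log (2 / δ) / N) / lam)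
        * R ^ 2 * ‖u‖ * 1 := by ring
    _ ≤ _ := mul_le_mul_of_nonneg_left h1 (by positivity)
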